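/- Model. Let $c:(0,\infty)\to\mathbb R$ be strictly increasing, convex and three times differentiable with $c'''\ge 0$, and let $c_S>0$, $\overline w\ge 0$. Consider an M/M/$N$ queue with Poisson arrivals of rate $\lambda>0$, FIFO service and exponential service times, in which an arriving customer who finds idle servers is routed to one of them uniformly at random. Server $i$ chooses a service rate $\mu_i>\lambda/N$ and has utility $U_i(\mu_1,\dots,\mu_N)=I_i(\mu_1,\dots,\mu_N)-c(\mu_i)$, where $I_i$ is the steady state fraction of time that server $i$ is idle. A symmetric equilibrium is a rate $\mu>\lambda/N$ such that $(\mu,\dots,\mu)$ is a Nash equilibrium of this game. The total cost is $C^{\star,\lambda}(N)=c_S N+\overline w\,\lambda\,\overline W^{\star}$, where $\overline W^{\star}$ is the mean steady state waiting time when all servers work at the largest symmetric equilibrium rate. A staffing policy $\lambda\mapsto N^\lambda\in\{0,1,2,\dots\}$ is admissible if for all large $\lambda$ a symmetric equilibrium exists, and symmetric equilibria $\mu^{\star,\lambda}$ can be chosen with $\limsup_{\lambda\to\infty}\mu^{\star,\lambda}<\infty$. An optimal policy $N^{opt,\lambda}$ is an admissible policy whose cost at each $\lambda$ is minimal among all admissible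 policies (at those $\lambda$ at which an equilibrium exists under the policy it is compared with). A policy $N^\lambda$ is asymptotically optimal if it is admissible and $C^{\star,\lambda}(N^\lambda)/C^{\star,\lambda}(N^{opt,\lambda})\to 1$ as $\lambda\to\infty$ for every optimal policy $N^{opt}$. Let $$a^\star=\sup\Big\{a>0:\ \tfrac1a-\tfrac1\mu=\tfrac{\mu^2}{a^2}\,c'(\mu)\ \text{for some } \mu>0\Big\}.$$ Theorem. The supremum is finite and $0<a^\star<\infty$. Optimal policies exist, and every optimal policy satisfies $\lim_{\lambda\to\infty}C^{\star,\lambda}(N^{opt,\lambda})/\lambda=c_S/a^\star$. Let $N^{ao,\lambda}=\lambda/a^\star+o(\lambda)$. (1) If $N^{ao,\lambda}-\lambda/a^\star\ge 0$ for all large $\lambda$, then $N^{ao,\lambda}$ is admissible. (2) Whenever $N^{ao,\lambda}$ is admissible (in particular in case (1)), it is asymptotically optimal among all admissible staffing policies, $\lim_{\lambda\to\infty}C^{\star,\lambda}(N^{ao,\lambda})/\lambda=c_S/a^\star$, and the system runs in the quality-driven regime: there is $\delta>0$ such that $N^{ao,\lambda}\ge \lambda/\mu+\delta\lambda$ for all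 large $\lambda$ and every symmetric equilibrium $\mu$ of the system with arrival rate $\lambda$ and $N^{ao,\lambda}$ servers. -/

import Mathlib

open Filter Topology Asymptotics

namespace StrategicServers

/-! ### The M/M/N queue with heterogeneous servers and Random routing -/

/-- States of the queue with `N` servers: `Sum.inl B` means that exactly the servers in `B` are busy
and nobody waits; `Sum.inr k` means that all servers are busy and `k + 1` customers wait. -/
abbrev State (N : ℕ) : Type := Finset (Fin N) ⊕ ℕ

/-- Transition rates of the Markov chain with arrival rate `lam` and service rates `mu`.
An arrival that finds idle servers goes to one of them uniformly at random, and otherwise joins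
the queue; busy server `i` completes a service at rate `mu i`, and then takes the next waiting
customer if there is one. -/
noncomputable def rate {N : ℕ} (lam : ℝ) (mu : Fin N → ℝ) : State N → State N → ℝ
  | Sum.inl B, Sum.inl B' =>
      (∑ i, if i ∉ B ∧ B' = insert i B then lam / ((Bᶜ).card : ℝ) else 0)
        + ∑ i, if i ∈ B ∧ B' = B.erase i then mu i else 0
  | Sum.inl B, Sum.inr k => if B = Finset.univ ∧ k = 0 then lam else 0
  | Sum.inr k, Sum.inl B => if B = Finset.univ ∧ k = 0 then ∑ i, mu i else 0
  | Sum.inr k, Sum.inr l =>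
      (if l = k + 1 then lam else 0) + (if k = l + 1 then ∑ i, mu i else 0)

/-- Stationary distributions of the chain: probability vectors satisfying global balance. -/
structure IsStationary {N : ℕ} (lam : ℝ) (mu : Fin N → ℝ) (p : State N → ℝ) : Prop where
  nonneg : ∀ s, 0 ≤ p s
  hasSum : HasSum p 1
  balance : ∀ s, p s * ∑' t, rate lam mu s t = ∑' t, p t * rate lam mu t s

open Classical in
/-- The steady state distribution. It exists and is unique when `lam > 0`, all service rates are
positive and `lam < ∑ i, mu i`; it is only used in that case. -/
noncomputable def steadyState {N : ℕ} (lam : ℝ) (mu : Fin N → ℝ) : State N → ℝ :=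
  if h : ∃ p, IsStationary lam mu p then h.choose else 0

/-- Steady state fraction of time during which server `i` is idle. -/
noncomputable def idleTime {N : ℕ} (lam : ℝ) (mu : Fin N → ℝ) (i : Fin N) : ℝ :=
  ∑ B : Finset (Fin N), if i ∉ B then steadyState lam mu (Sum.inl B) else 0

/-- Law of the waiting time (until service starts) of a customer who on arrival finds the system
in state `s`, under First In First Out: zero if some server is idle, and otherwise, with `q`
customers already waiting, the time of `q + 1` successive service completions, which are
independent exponentials of rate `∑ i, mu i`. -/
noncomputable def waitingLaw {N : ℕ} (mu : Fin N → ℝ) : State N → MeasureTheory.Measure ℝ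
  | Sum.inl B =>
      if B = Finset.univ then ProbabilityTheory.gammaMeasure 1 (∑ i, mu i)
      else MeasureTheory.Measure.dirac 0
  | Sum.inr k => ProbabilityTheory.gammaMeasure ((k : ℝ) + 2) (∑ i, mu i)

/-- Mean steady state waiting time; Poisson arrivals see the steady state distribution. -/
noncomputable def meanWait {N : ℕ} (lam : ℝ) (mu : Fin N → ℝ) : ℝ :=
  ∑' s, steadyState lam mu s * ∫ t, t ∂(waitingLaw mu s)

/-! ### The game between the servers -/

/-- Effort cost functions: defined for positive service rates, strictly increasing, convex, three
times differentiable with nonnegative third derivative. -/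
structure IsEffortCost (c : ℝ → ℝ) : Prop where
  strictMono : StrictMonoOn c (Set.Ioi 0)
  convex : ConvexOn ℝ (Set.Ioi 0) c
  differentiable : ∀ k < 3, ∀ x : ℝ, 0 < x → DifferentiableAt ℝ (iteratedDeriv k c) x
  third_nonneg : ∀ x : ℝ, 0 < x → 0 ≤ iteratedDeriv 3 c x

/-- Utility of server `i`: idle time minus effort cost. -/
noncomputable def utility {N : ℕ} (c : ℝ → ℝ) (lam : ℝ) (mu : Fin N → ℝ) (i : Fin N) : ℝ :=
  idleTime lam mu i - c (mu i)

/-- Nash equilibria of the game in which every server chooses a service rate `> lam / N`. -/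
def IsNash {N : ℕ} (c : ℝ → ℝ) (lam : ℝ) (mu : Fin N → ℝ) : Prop :=
  (∀ i, lam < N * mu i) ∧
    ∀ i, ∀ x : ℝ, lam < N * x →
      utility c lam (Function.update mu i x) i ≤ utility c lam mu i

/-- `m` is a symmetric equilibrium service rate, under which the system is stable. -/
def IsSymmetricEquilibrium (c : ℝ → ℝ) (lam : ℝ) (N : ℕ) (m : ℝ) : Prop :=
  lam < N * m ∧ IsNash c lam (fun _ : Fin N => m)

/-- The largest symmetric equilibrium service rate (for `lam > 0`, the set of equilibrium rates is
bounded, and it contains its supremum if it is not empty). -/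
noncomputable def largestEquilibrium (c : ℝ → ℝ) (lam : ℝ) (N : ℕ) : ℝ :=
  sSup {m | IsSymmetricEquilibrium c lam N m}

/-- Total cost: linear staffing cost plus linear waiting cost, when the servers work at the largest
symmetric equilibrium service rate. -/
noncomputable def totalCost (c : ℝ → ℝ) (cS w lam : ℝ) (N : ℕ) : ℝ :=
  cS * N + w * lam * meanWait lam (fun _ : Fin N => largestEquilibrium c lam N)

/-! ### Staffing policies: the number of servers as a function of the arrival rate -/

/-- For all large arrival rates a symmetric equilibrium exists, and the equilibria can be chosen
such that their upper limit is finite. -/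
def Admissible (c : ℝ → ℝ) (N : ℝ → ℕ) : Prop :=
  (∀ᶠ lam in atTop, ∃ m, IsSymmetricEquilibrium c lam (N lam) m) ∧
    ∃ m : ℝ → ℝ, (∀ᶠ lam in atTop, IsSymmetricEquilibrium c lam (N lam) (m lam)) ∧
      IsBoundedUnder (· ≤ ·) atTop m

/-- An admissible policy whose cost at every arrival rate is minimal among all admissible policies.
Costs are compared at those arrival rates at which they are defined, that is, at which a symmetric
equilibrium exists. -/
def IsOptimalPolicy (c : ℝ → ℝ) (cS w : ℝ) (Nopt : ℝ → ℕ) : Prop :=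
  Admissible c Nopt ∧
    ∀ N : ℝ → ℕ, Admissible c N → ∀ lam : ℝ, 0 < lam →
      (∃ m, IsSymmetricEquilibrium c lam (N lam) m) →
        (∃ m, IsSymmetricEquilibrium c lam (Nopt lam) m) ∧
          totalCost c cS w lam (Nopt lam) ≤ totalCost c cS w lam (N lam)

/-- Admissible, with a cost asymptotically equivalent to the optimal cost. -/
def AsymptoticallyOptimal (c : ℝ → ℝ) (cS w : ℝ) (N : ℝ → ℕ) : Prop :=
  Admissible c N ∧
    ∀ Nopt : ℝ → ℕ, IsOptimalPolicy c cS w Nopt →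
      Tendsto (fun lam => totalCost c cS w lam (N lam) / totalCost c cS w lam (Nopt lam))
        atTop (𝓝 1)

/-- Quality-driven regime: in every symmetric equilibrium the staffing exceeds the offered load
`lam / m` by order `lam`. -/
def QualityDriven (c : ℝ → ℝ) (N : ℝ → ℕ) : Prop :=
  ∃ δ : ℝ, 0 < δ ∧ ∀ᶠ lam in atTop, ∀ m : ℝ,
    IsSymmetricEquilibrium c lam (N lam) m → lam / m + δ * lam ≤ N lam

/-- The set of `a > 0` for which the limiting equilibrium equation has a solution `m > 0`. -/
def solvableSet (c : ℝ → ℝ) : Set ℝ :=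
  {a | 0 < a ∧ ∃ m : ℝ, 0 < m ∧ 1 / a - 1 / m = m ^ 2 / a ^ 2 * deriv c m}

/-- The critical staffing parameter. -/
noncomputable def aStar (c : ℝ → ℝ) : ℝ := sSup (solvableSet c)

end StrategicServers

/-!
For fixed service rates the chain is reversible: detailed balance along busy sets and along the
queue gives a product form stationary law, and it is the only one, since the ratio of two stationary
laws attains its maximum on the finitely many states without a queue, from where the maximum
propagates along all transitions. If one of `N` servers deviates from the common rate, its idle time
is therefore an explicit rational function of its own rate, whose coefficients involve the Erlang C
formula. It lies below its tangent at the common rate once the spare capacity is large enough, so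
the first order condition, which is always necessary, is then sufficient as well.

Written in terms of `a = lam / N`, the first order condition is the equation that defines `aStar`
up to an error of order `1 / lam`. As `aStar` is the largest solvable `a`, and equilibrium rates are
bounded, compactness shows that equilibria force `lam / N` to be asymptotically at most `aStar`.
Conversely, staffing at least `lam / aStar` servers makes the intermediate value theorem yield
an equilibrium. In both cases the spare capacity in equilibrium is of order `lam`, so the waiting
cost is negligible compared to the staffing cost, and minimizing the cost amounts to minimizing `N`.
-/

namespace StrategicServers
/-! ### Reversible chains -/

section Reversible

variable {σ : Type*} {q : σ → σ → ℝ} {w p : σ → ℝ}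

lemma div_eq_div_of_rate_pos_of_forall_le (hq : ∀ s t, 0 ≤ q s t) (hw : ∀ s, 0 < w s)
    (hrev : ∀ s t, w s * q s t = w t * q t s) {s t : σ} (hfin : (Function.support (q s)).Finite)
    (hbal : p s * ∑' t, q s t = ∑' t, p t * q t s) (hmax : ∀ t, p t / w t ≤ p s / w s)
    (hst : 0 < q s t) : p t / w t = p s / w s := by
  have hin : ∀ t, p t * q t s = w s * (q s t * (p t / w t)) := fun t => by
    rw [← mul_assoc, hrev]
    field_simp [(hw t).ne']
  have hflow : ∑' t, q s t * (p s / w s - p t / w t) = 0 := by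
    have hsum (f : σ → ℝ) : Summable fun t => q s t * f t :=
      summable_of_hasFiniteSupport (hfin.subset (Function.support_mul_subset_left _ _))
    have hws := (hw s).ne'
    simp only [mul_sub]
    rw [(hsum _).tsum_sub (hsum _), tsum_mul_right, sub_eq_zero, ← mul_right_inj' hws,
      ← tsum_mul_left, ← tsum_congr hin, ← hbal]
    field_simp
  have hterm : ∀ t, 0 ≤ q s t * (p s / w s - p t / w t) :=
    fun t => mul_nonneg (hq s t) (sub_nonneg.2 (hmax t))
  have hzero := (hasSum_zero_iff_of_nonneg hterm).1 (hflow ▸ (summable_of_hasFiniteSupport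
    (hfin.subset (Function.support_mul_subset_left _ _))).hasSum)
  have := (mul_eq_zero.1 (congrFun hzero t)).resolve_left hst.ne'
  linarith

lemma div_eq_div_of_reachable_of_forall_le (hq : ∀ s t, 0 ≤ q s t) (hw : ∀ s, 0 < w s)
    (hrev : ∀ s t, w s * q s t = w t * q t s) (hfin : ∀ s, (Function.support (q s)).Finite)
    (hbal : ∀ s, p s * ∑' t, q s t = ∑' t, p t * q t s) {s t : σ}
    (hmax : ∀ t, p t / w t ≤ p s / w s)
    (hst : Relation.ReflTransGen (fun s t => 0 < q s t) s t) : p t / w t = p s / w s := by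
  induction hst with
  | refl => rfl
  | tail _ hstep ih =>
    rw [← ih] at hmax ⊢
    exact div_eq_div_of_rate_pos_of_forall_le hq hw hrev (hfin _) (hbal _) hmax hstep

lemma reachable_symm_of_detailedBalance (hw : ∀ s, 0 < w s)
    (hrev : ∀ s t, w s * q s t = w t * q t s) {s t : σ}
    (h : Relation.ReflTransGen (fun s t => 0 < q s t) s t) :
    Relation.ReflTransGen (fun s t => 0 < q s t) t s := by
  have : Std.Symm fun s t => 0 < q s t :=
    ⟨fun s t hst => pos_of_mul_pos_right (hrev s t ▸ mul_pos (hw s) hst) (hw t).le⟩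
  exact Std.Symm.symm _ _ h

end Reversible

/-! ### The stationary distribution in product form -/

/-- Unnormalized stationary weights of the queue, in product form. -/
noncomputable def weight {N : ℕ} (lam : ℝ) (mu : Fin N → ℝ) : State N → ℝ
  | Sum.inl B => ((Bᶜ).card.factorial : ℝ) * ∏ i ∈ B, lam / mu i
  | Sum.inr k => (∏ i, lam / mu i) * (lam / ∑ i, mu i) ^ (k + 1)

/-- The state in which all servers are busy and `k` customers wait. -/
def queueState (N : ℕ) : ℕ → State N
  | 0 => Sum.inl Finset.univ
  | k + 1 => Sum.inr k

lemma queueState_injective (N : ℕ) : Function.Injective (queueState N) := by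
  rintro (_ | j) (_ | k) h <;> simp_all [queueState]

section Chain

variable {N : ℕ} {lam : ℝ} {mu : Fin N → ℝ}

lemma weight_queueState (k : ℕ) :
    weight lam mu (queueState N k) = (∏ i, lam / mu i) * (lam / ∑ i, mu i) ^ k := by
  cases k <;> simp [queueState, weight]

lemma weight_pos (hlam : 0 < lam) (hmu : ∀ i, 0 < mu i) (hM : 0 < ∑ i, mu i) (s : State N) :
    0 < weight lam mu s := by
  have hprod (B : Finset (Fin N)) : 0 < ∏ i ∈ B, lam / mu i :=
    Finset.prod_pos fun i _ => div_pos hlam (hmu i)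
  rcases s with B | k
  · exact mul_pos (by positivity) (hprod B)
  · exact mul_pos (hprod _) (by positivity)

lemma rate_nonneg (hlam : 0 ≤ lam) (hmu : ∀ i, 0 ≤ mu i) (s t : State N) :
    0 ≤ rate lam mu s t := by
  have hM : 0 ≤ ∑ i, mu i := Finset.sum_nonneg fun i _ => hmu i
  rcases s with B | k <;> rcases t with B' | l <;> simp only [rate]
  · refine add_nonneg (Finset.sum_nonneg fun i _ => ?_) (Finset.sum_nonneg fun i _ => ?_)
    · split_ifs <;> positivity
    · split_ifs
      exacts [hmu i, le_rfl]
  all_goals split_ifs <;> positivity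

lemma rate_queueState_succ_left (k : ℕ) (t : State N) :
    rate lam mu (queueState N (k + 1)) t =
      (if t = queueState N (k + 2) then lam else 0) +
        if t = queueState N k then ∑ i, mu i else 0 := by
  rcases t with B | l <;> rcases k with _ | k <;> simp [queueState, rate, eq_comm]

lemma rate_queueState_succ_right (k : ℕ) (s : State N) :
    rate lam mu s (queueState N (k + 1)) =
      (if s = queueState N k then lam else 0) +
        if s = queueState N (k + 2) then ∑ i, mu i else 0 := by
  rcases s with B | l <;> rcases k with _ | k <;> simp [queueState, rate, eq_comm]

lemma finite_support_rate (s : State N) : (Function.support (rate lam mu s)).Finite := by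
  have hcover : ∃ k, ∀ l, k < l → rate lam mu s (Sum.inr l) = 0 := by
    rcases s with B | k
    · exact ⟨0, fun l hl => by simp [rate, hl.ne']⟩
    · exact ⟨k + 1, fun l hl => by simp only [rate]; grind⟩
  obtain ⟨k, hk⟩ := hcover
  refine ((Set.finite_range Sum.inl).union ((Set.finite_Iic k).image Sum.inr)).subset ?_
  rintro (B | l) hl
  · exact Or.inl ⟨B, rfl⟩
  · exact Or.inr ⟨l, not_lt.1 fun h => hl (hk l h), rfl⟩

lemma weight_mul_arrival (hmu : ∀ i, mu i ≠ 0) (B B' : Finset (Fin N)) :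
    weight lam mu (Sum.inl B) *
        (∑ i, if i ∉ B ∧ B' = insert i B then lam / ((Bᶜ).card : ℝ) else 0) =
      weight lam mu (Sum.inl B') * ∑ i, if i ∈ B' ∧ B = B'.erase i then mu i else 0 := by
  rw [Finset.mul_sum, Finset.mul_sum]
  refine Finset.sum_congr rfl fun i _ => ?_
  by_cases h : i ∉ B ∧ B' = insert i B
  · obtain ⟨hi, rfl⟩ := h
    have hcard : (Bᶜ).card = ((insert i B)ᶜ).card + 1 := by
      rw [Finset.compl_insert, Finset.card_erase_add_one (Finset.mem_compl.2 hi)]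
    have hi₀ := hmu i
    rw [if_pos ⟨hi, rfl⟩, if_pos ⟨Finset.mem_insert_self _ _, (Finset.erase_insert hi).symm⟩]
    simp only [weight]
    rw [Finset.prod_insert hi, hcard, Nat.factorial_succ]
    push_cast
    field_simp
  · rw [if_neg h, if_neg, mul_zero, mul_zero]
    rintro ⟨hi, rfl⟩
    exact h ⟨Finset.notMem_erase _ _, (Finset.insert_erase hi).symm⟩

lemma weight_queueState_mul (hM : ∑ i, mu i ≠ 0) (k : ℕ) :
    weight lam mu (queueState N k) * lam =
      weight lam mu (queueState N (k + 1)) * ∑ i, mu i := by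
  rw [weight_queueState, weight_queueState, pow_succ]
  field_simp

lemma detailedBalance_queueState (hM : ∑ i, mu i ≠ 0) (s : State N) (k : ℕ) :
    weight lam mu s * rate lam mu s (queueState N (k + 1)) =
      weight lam mu (queueState N (k + 1)) * rate lam mu (queueState N (k + 1)) s := by
  have hne : queueState N k ≠ queueState N (k + 2) := (queueState_injective N).ne (by omega)
  rw [rate_queueState_succ_left, rate_queueState_succ_right]
  by_cases h₁ : s = queueState N k
  · subst h₁
    simp [hne, weight_queueState_mul hM]
  by_cases h₂ : s = queueState N (k + 2)
  · subst h₂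
    simp [hne.symm, weight_queueState_mul hM]
  simp [h₁, h₂]

lemma detailedBalance_weight (hmu : ∀ i, mu i ≠ 0) (hM : ∑ i, mu i ≠ 0) (s t : State N) :
    weight lam mu s * rate lam mu s t = weight lam mu t * rate lam mu t s := by
  rcases t with B' | k
  · rcases s with B | k
    · simp only [rate]
      rw [mul_add, mul_add, weight_mul_arrival hmu, weight_mul_arrival hmu, add_comm]
    · exact (detailedBalance_queueState hM (Sum.inl B') k).symm
  · exact detailedBalance_queueState hM s k

lemma hasSum_weight (hlam : 0 < lam) (hM : lam < ∑ i, mu i) :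
    HasSum (weight lam mu) ((∑ B, weight lam mu (Sum.inl B)) +
      (∏ i, lam / mu i) * (lam / (∑ i, mu i - lam))) := by
  have hM₀ := hlam.trans hM
  have htail := (hasSum_geometric_of_lt_one (by positivity) ((div_lt_one hM₀).2 hM)).mul_left
    ((∏ i, lam / mu i) * (lam / ∑ i, mu i))
  refine HasSum.sum (hasSum_fintype _) ?_
  convert! htail using 1
  · funext k
    simp only [Function.comp, weight]
    ring
  · have : ∑ i, mu i - lam ≠ 0 := (sub_pos.2 hM).ne'
    field_simp

lemma isStationary_weight (hlam : 0 < lam) (hmu : ∀ i, 0 < mu i) (hM : lam < ∑ i, mu i) :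
    IsStationary lam mu fun s => weight lam mu s / ∑' t, weight lam mu t := by
  have hM₀ := hlam.trans hM
  have hw := weight_pos hlam hmu hM₀
  have hs := (hasSum_weight hlam hM).summable
  have htsum : 0 < ∑' t, weight lam mu t := hs.tsum_pos (fun t => (hw t).le) (Sum.inr 0) (hw _)
  refine ⟨fun s => (div_pos (hw s) htsum).le, ?_, fun s => ?_⟩
  · simpa only [div_self htsum.ne'] using hs.hasSum.div_const (∑' t, weight lam mu t)
  · rw [← tsum_mul_left]
    refine tsum_congr fun t => ?_
    rw [div_mul_eq_mul_div, detailedBalance_weight (fun i => (hmu i).ne') hM₀.ne',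
      mul_div_right_comm]

lemma rate_insert_pos (hlam : 0 < lam) (hmu : ∀ i, 0 ≤ mu i) {B : Finset (Fin N)} {i : Fin N}
    (hi : i ∉ B) : 0 < rate lam mu (Sum.inl B) (Sum.inl (insert i B)) := by
  have : 0 < (Bᶜ).card := Finset.card_pos.2 ⟨i, Finset.mem_compl.2 hi⟩
  refine add_pos_of_pos_of_nonneg
    (Finset.sum_pos' (fun j _ => by positivity) ⟨i, Finset.mem_univ _, ?_⟩)
    (Finset.sum_nonneg fun j _ => ?_)
  · rw [if_pos ⟨hi, rfl⟩]
    positivity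
  · split_ifs
    exacts [hmu j, le_rfl]

lemma reachable_of_empty (hlam : 0 < lam) (hmu : ∀ i, 0 ≤ mu i) (t : State N) :
    Relation.ReflTransGen (fun s t => 0 < rate lam mu s t) (Sum.inl ∅) t := by
  have hbusy (B : Finset (Fin N)) :
      Relation.ReflTransGen (fun s t => 0 < rate lam mu s t) (Sum.inl ∅) (Sum.inl B) := by
    induction B using Finset.induction_on with
    | empty => exact .refl
    | insert i B hi ih => exact ih.tail (rate_insert_pos hlam hmu hi)
  have hqueue (k : ℕ) :
      Relation.ReflTransGen (fun s t => 0 < rate lam mu s t) (Sum.inl ∅) (queueState N k) := by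
    induction k with
    | zero => exact hbusy _
    | succ k ih =>
      refine ih.tail ?_
      rw [rate_queueState_succ_right, if_pos rfl]
      have := Finset.sum_nonneg fun i (_ : i ∈ Finset.univ) => hmu i
      positivity
  rcases t with B | k
  exacts [hbusy B, hqueue (k + 1)]

lemma IsStationary.balance_queueState {p : State N → ℝ} (hp : IsStationary lam mu p) (k : ℕ) :
    p (queueState N (k + 1)) * (lam + ∑ i, mu i) =
      lam * p (queueState N k) + (∑ i, mu i) * p (queueState N (k + 2)) := by
  have hout := (hasSum_ite_eq (queueState N (k + 2)) lam).add
    (hasSum_ite_eq (queueState N k) (∑ i, mu i))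
  have hin := (hasSum_ite_eq (queueState N k) (lam * p (queueState N k))).add
    (hasSum_ite_eq (queueState N (k + 2)) ((∑ i, mu i) * p (queueState N (k + 2))))
  have hb := hp.balance (queueState N (k + 1))
  simp only [rate_queueState_succ_left, rate_queueState_succ_right] at hb
  rw [hout.tsum_eq] at hb
  rw [hb, ← hin.tsum_eq]
  refine tsum_congr fun t => ?_
  rw [mul_add]
  congr 1 <;> split_ifs with h <;> simp [h, mul_comm]

-- The flow `lam * p k - M * p (k + 1)` across each cut of the queue is the same for all `k`, and
-- it tends to zero because `p` is summable.
lemma IsStationary.lam_mul_queueState {p : State N → ℝ} (hp : IsStationary lam mu p) (k : ℕ) :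
    lam * p (queueState N k) = (∑ i, mu i) * p (queueState N (k + 1)) := by
  set flow : ℕ → ℝ := fun k => lam * p (queueState N k) - (∑ i, mu i) * p (queueState N (k + 1))
  have hconst (k : ℕ) : flow k = flow 0 := by
    induction k with
    | zero => rfl
    | succ k ih => rw [← ih]; linarith [hp.balance_queueState k]
  have hlim : Tendsto (fun k => p (queueState N k)) atTop (𝓝 0) :=
    (hp.hasSum.summable.comp_injective (queueState_injective N)).tendsto_atTop_zero
  have hflow : Tendsto flow atTop (𝓝 (lam * 0 - (∑ i, mu i) * 0)) :=
    (hlim.const_mul _).sub ((hlim.comp (tendsto_add_atTop_nat 1)).const_mul _)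
  have hzero : flow 0 = lam * 0 - (∑ i, mu i) * 0 :=
    tendsto_nhds_unique (tendsto_const_nhds.congr fun k => (hconst k).symm) hflow
  linarith [hconst k]

lemma IsStationary.div_weight_queueState {p : State N → ℝ} (hp : IsStationary lam mu p)
    (hlam : 0 < lam) (hmu : ∀ i, 0 < mu i) (hM : 0 < ∑ i, mu i) (k : ℕ) :
    p (queueState N k) / weight lam mu (queueState N k) =
      p (queueState N 0) / weight lam mu (queueState N 0) := by
  have hw := weight_pos hlam hmu hM
  induction k with
  | zero => rfl
  | succ k ih =>
    rw [← ih, div_eq_div_iff (hw _).ne' (hw _).ne', ← mul_right_inj' hM.ne', ← mul_assoc,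
      ← hp.lam_mul_queueState, mul_left_comm, mul_comm (∑ i, mu i), ← weight_queueState_mul hM.ne']
    ring

lemma IsStationary.eq_weight_div_tsum {p : State N → ℝ} (hp : IsStationary lam mu p)
    (hlam : 0 < lam) (hmu : ∀ i, 0 < mu i) (hM : 0 < ∑ i, mu i) (s : State N) :
    p s = weight lam mu s / ∑' t, weight lam mu t := by
  have hw := weight_pos hlam hmu hM
  have hrev := detailedBalance_weight (lam := lam) (fun i => (hmu i).ne') hM.ne'
  have hreach := reachable_of_empty hlam fun i => (hmu i).le
  obtain ⟨A, hA⟩ := Finite.exists_max fun B => p (Sum.inl B) / weight lam mu (Sum.inl B)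
  have hmax : ∀ t, p t / weight lam mu t ≤ p (Sum.inl A) / weight lam mu (Sum.inl A) := by
    rintro (B | k)
    · exact hA B
    · exact (hp.div_weight_queueState hlam hmu hM (k + 1)).trans_le (hA _)
  set C := p (Sum.inl A) / weight lam mu (Sum.inl A)
  have hprop (t : State N) : p t = C * weight lam mu t := by
    rw [← div_eq_iff (hw t).ne']
    exact div_eq_div_of_reachable_of_forall_le (rate_nonneg hlam.le fun i => (hmu i).le) hw hrev
      finite_support_rate hp.balance hmax
      ((reachable_symm_of_detailedBalance hw hrev (hreach _)).trans (hreach t))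
  have hone : C * ∑' t, weight lam mu t = 1 := by
    rw [← tsum_mul_left, ← hp.hasSum.tsum_eq]
    exact tsum_congr fun t => (hprop t).symm
  rw [hprop s, eq_div_iff (right_ne_zero_of_mul_eq_one hone), mul_right_comm, hone, one_mul]

lemma steadyState_eq (hlam : 0 < lam) (hmu : ∀ i, 0 < mu i) (hM : lam < ∑ i, mu i)
    (s : State N) : steadyState lam mu s = weight lam mu s / ∑' t, weight lam mu t := by
  have h : ∃ p, IsStationary lam mu p := ⟨_, isStationary_weight hlam hmu hM⟩
  rw [steadyState, dif_pos h]
  exact h.choose_spec.eq_weight_div_tsum hlam hmu (hlam.trans hM) s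

end Chain

/-! ### Waiting times -/

lemma integral_id_gammaMeasure {a r : ℝ} (ha : 0 < a) (hr : 0 < r) :
    ∫ t, t ∂(ProbabilityTheory.gammaMeasure a r) = a / r := by
  have hdensity : ∀ t : ℝ, (ProbabilityTheory.gammaPDF a r t).toReal • t =
      Set.indicator (Set.Ioi 0)
        (fun t => r ^ a / Real.Gamma a * (t ^ (a + 1 - 1) * Real.exp (-(r * t)))) t := by
    intro t
    rcases lt_trichotomy t 0 with ht | rfl | ht
    · simp [ProbabilityTheory.gammaPDF_of_neg ht, ht.le]
    · simp
    · rw [Set.indicator_of_mem (Set.mem_Ioi.2 ht), ProbabilityTheory.gammaPDF_of_nonneg ht.le,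
        ENNReal.toReal_ofReal (by positivity), smul_eq_mul, add_sub_cancel_right,
        Real.rpow_sub_one ht.ne']
      field_simp
  have := Real.Gamma_pos_of_pos ha
  have := Real.rpow_pos_of_pos hr a
  have hmeas : Measurable (ProbabilityTheory.gammaPDF a r) :=
    (ProbabilityTheory.measurable_gammaPDFReal a r).ennreal_ofReal
  rw [ProbabilityTheory.gammaMeasure, integral_withDensity_eq_integral_toReal_smul hmeas
    (MeasureTheory.ae_of_all _ fun t => by simp [ProbabilityTheory.gammaPDF])]
  simp_rw [hdensity]
  rw [MeasureTheory.integral_indicator measurableSet_Ioi, MeasureTheory.integral_const_mul,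
    Real.integral_rpow_mul_exp_neg_mul_Ioi (by linarith) hr, Real.Gamma_add_one ha.ne',
    Real.rpow_add_one (by positivity), one_div, Real.inv_rpow hr.le]
  field_simp

section Waiting

variable {N : ℕ} {lam : ℝ} {mu : Fin N → ℝ}

lemma integral_waitingLaw_queueState (hM : 0 < ∑ i, mu i) (k : ℕ) :
    ∫ t, t ∂(waitingLaw mu (queueState N k)) = (k + 1) / ∑ i, mu i := by
  rcases k with _ | k
  · simp [queueState, waitingLaw, integral_id_gammaMeasure one_pos hM]
  · rw [queueState, waitingLaw, integral_id_gammaMeasure (by positivity) hM]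
    push_cast
    ring

lemma integral_waitingLaw_of_notMem_range {s : State N} (hs : s ∉ Set.range (queueState N)) :
    ∫ t, t ∂(waitingLaw mu s) = 0 := by
  rcases s with B | k
  · have hB : B ≠ Finset.univ := fun h => hs ⟨0, h ▸ rfl⟩
    rw [waitingLaw, if_neg hB, MeasureTheory.integral_dirac]
  · exact absurd ⟨k + 1, rfl⟩ hs

lemma steadyState_queueState (hlam : 0 < lam) (hmu : ∀ i, 0 < mu i) (hM : lam < ∑ i, mu i)
    (k : ℕ) : steadyState lam mu (queueState N k) =
      steadyState lam mu (queueState N 0) * (lam / ∑ i, mu i) ^ k := by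
  simp only [steadyState_eq hlam hmu hM, weight_queueState]
  ring

lemma meanWait_eq (hlam : 0 < lam) (hmu : ∀ i, 0 < mu i) (hM : lam < ∑ i, mu i) :
    meanWait lam mu =
      steadyState lam mu (queueState N 0) * (∑ i, mu i) / (∑ i, mu i - lam) ^ 2 := by
  have hM₀ := hlam.trans hM
  have hr : ‖lam / ∑ i, mu i‖ < 1 := by
    rw [Real.norm_of_nonneg (by positivity)]
    exact (div_lt_one hM₀).2 hM
  have hsum := (hasSum_choose_mul_geometric_of_norm_lt_one 1 hr).mul_left
    (steadyState lam mu (queueState N 0) / ∑ i, mu i)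
  rw [meanWait, ← (queueState_injective N).tsum_eq fun s hs => by
    by_contra h
    exact hs (by simp only [integral_waitingLaw_of_notMem_range h, mul_zero])]
  convert hsum.tsum_eq using 1
  · refine tsum_congr fun k => ?_
    rw [steadyState_queueState hlam hmu hM, integral_waitingLaw_queueState hM₀,
      Nat.choose_one_right]
    push_cast
    ring
  · have : ∑ i, mu i - lam ≠ 0 := (sub_pos.2 hM).ne'
    rw [one_sub_div hM₀.ne', one_add_one_eq_two]
    field_simp

lemma isStationary_steadyState (hlam : 0 < lam) (hmu : ∀ i, 0 < mu i) (hM : lam < ∑ i, mu i) :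
    IsStationary lam mu (steadyState lam mu) := by
  rw [funext (steadyState_eq hlam hmu hM)]
  exact isStationary_weight hlam hmu hM

lemma meanWait_nonneg (hlam : 0 < lam) (hmu : ∀ i, 0 < mu i) (hM : lam < ∑ i, mu i) :
    0 ≤ meanWait lam mu := by
  rw [meanWait_eq hlam hmu hM]
  have := (isStationary_steadyState hlam hmu hM).nonneg (queueState N 0)
  have := hlam.trans hM
  positivity

lemma meanWait_le (hlam : 0 < lam) (hmu : ∀ i, 0 < mu i) (hM : lam < ∑ i, mu i) :
    meanWait lam mu ≤ 1 / (∑ i, mu i - lam) := by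
  have hp := isStationary_steadyState hlam hmu hM
  have hM₀ := hlam.trans hM
  have hgap := sub_pos.2 hM
  have hbusy : steadyState lam mu (queueState N 0) * (∑ i, mu i) / (∑ i, mu i - lam) ≤ 1 := by
    have hsum := (hasSum_geometric_of_lt_one (by positivity) ((div_lt_one hM₀).2 hM)).mul_left
      (steadyState lam mu (queueState N 0))
    simp only [← steadyState_queueState hlam hmu hM] at hsum
    have hle := hasSum_le_inj (queueState N) (queueState_injective N) (fun s _ => hp.nonneg s)
      (fun _ => le_rfl) hsum hp.hasSum
    rwa [one_sub_div hM₀.ne', inv_div, ← mul_div_assoc] at hle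
  rw [meanWait_eq hlam hmu hM, pow_two, ← div_div]
  exact div_le_div_of_nonneg_right hbusy hgap.le

end Waiting

/-! ### Idle time of a server who deviates from a symmetric profile -/

/-- The truncated exponential series `∑_{j < N} ρ ^ j / j!`. -/
noncomputable def expSum (N : ℕ) (ρ : ℝ) : ℝ := ∑ j ∈ Finset.range N, ρ ^ j / (j.factorial : ℝ)

/-- The denominator of the Erlang C formula. -/
noncomputable def erlangNorm (N : ℕ) (ρ : ℝ) : ℝ :=
  (N - ρ) * expSum N ρ + ρ ^ N / ((N - 1).factorial : ℝ)

/-- The Erlang C formula: the probability of waiting in an M/M/`N` queue with offered load `ρ`. -/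
noncomputable def erlangC (N : ℕ) (ρ : ℝ) : ℝ :=
  ρ ^ N / ((N - 1).factorial : ℝ) / erlangNorm N ρ

section Erlang

variable {N : ℕ} {ρ : ℝ}

lemma sub_mul_expSum_pos (hρ : 0 ≤ ρ) (h : ρ < N) : 0 < (N - ρ) * expSum N ρ :=
  have hN : 0 < N := by exact_mod_cast hρ.trans_lt h
  mul_pos (sub_pos.2 h) (Finset.sum_pos' (fun j _ => by positivity)
    ⟨0, Finset.mem_range.2 hN, by simp⟩)

lemma erlangNorm_pos (hρ : 0 ≤ ρ) (h : ρ < N) : 0 < erlangNorm N ρ :=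
  add_pos_of_pos_of_nonneg (sub_mul_expSum_pos hρ h) (by positivity)

lemma erlangC_nonneg (hρ : 0 ≤ ρ) (h : ρ < N) : 0 ≤ erlangC N ρ :=
  div_nonneg (by positivity) (erlangNorm_pos hρ h).le

lemma erlangC_le_one (hρ : 0 ≤ ρ) (h : ρ < N) : erlangC N ρ ≤ 1 :=
  (div_le_one (erlangNorm_pos hρ h)).2 (le_add_of_nonneg_left (sub_mul_expSum_pos hρ h).le)

lemma one_sub_erlangC (hρ : 0 ≤ ρ) (h : ρ < N) :
    1 - erlangC N ρ = (N - ρ) * expSum N ρ / erlangNorm N ρ := by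
  rw [erlangC, one_sub_div (erlangNorm_pos hρ h).ne', erlangNorm, add_sub_cancel_right]

lemma continuousOn_erlangC (N : ℕ) : ContinuousOn (erlangC N) (Set.Ico 0 (N : ℝ)) := by
  refine ContinuousOn.div (by fun_prop) ?_ fun ρ hρ => (erlangNorm_pos hρ.1 hρ.2).ne'
  unfold erlangNorm expSum
  fun_prop

lemma sum_mul_pow_div_factorial (N : ℕ) (ρ : ℝ) :
    ∑ j ∈ Finset.range (N + 1), (j : ℝ) * (ρ ^ j / (j.factorial : ℝ)) = ρ * expSum N ρ := by
  rw [Finset.sum_range_succ', expSum, Finset.mul_sum, Nat.cast_zero, zero_mul, add_zero]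
  refine Finset.sum_congr rfl fun j _ => ?_
  rw [Nat.factorial_succ]
  push_cast
  field_simp
  ring

lemma erlangNorm_succ (n : ℕ) (ρ : ℝ) : erlangNorm (n + 1) ρ =
    ∑ j ∈ Finset.range (n + 1), (n + 1 - j) * (ρ ^ j / (j.factorial : ℝ)) := by
  simp only [sub_mul, Finset.sum_sub_distrib]
  rw [sum_mul_pow_div_factorial, ← Finset.mul_sum, ← expSum, erlangNorm, expSum, expSum,
    Finset.sum_range_succ, Nat.add_sub_cancel]
  push_cast
  ring

end Erlang

lemma idleTime_eq_div {N : ℕ} {lam : ℝ} {mu : Fin N → ℝ} (hlam : 0 < lam) (hmu : ∀ i, 0 < mu i)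
    (hM : lam < ∑ i, mu i) (i : Fin N) :
    idleTime lam mu i =
      (∑ B ∈ (Finset.univ.erase i).powerset, weight lam mu (Sum.inl B)) /
        ∑' t, weight lam mu t := by
  have hidle : ({B | i ∉ B} : Finset (Finset (Fin N))) = (Finset.univ.erase i).powerset := by
    ext B
    simp [Finset.subset_erase]
  rw [idleTime, ← Finset.sum_filter, hidle, Finset.sum_div]
  exact Finset.sum_congr rfl fun B _ => steadyState_eq hlam hmu hM _

section Deviation

variable {n : ℕ} {lam m x : ℝ}

lemma prod_update_const (f : ℝ → ℝ) {i : Fin (n + 1)} {B : Finset (Fin (n + 1))}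
    (hB : B ∈ (Finset.univ.erase i).powerset) :
    ∏ j ∈ B, f (Function.update (fun _ => m) i x j) = f m ^ B.card := by
  refine (Finset.prod_congr rfl fun j hj => ?_).trans (Finset.prod_const _)
  rw [Function.update_of_ne (Finset.ne_of_mem_erase (Finset.mem_powerset.1 hB hj))]

lemma sum_powerset_erase_factorial (k : ℕ) (i : Fin (n + 1)) (b : ℝ) :
    ∑ B ∈ (Finset.univ.erase i).powerset, ((n + k - B.card).factorial : ℝ) * b ^ B.card =
      n.factorial * ∑ j ∈ Finset.range (n + 1),
        ((n + k - j).factorial / (n - j).factorial : ℝ) * (b ^ j / (j.factorial : ℝ)) := by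
  rw [Finset.sum_powerset_apply_card (fun j => ((n + k - j).factorial : ℝ) * b ^ j),
    Finset.card_erase_of_mem (Finset.mem_univ i), Finset.card_univ, Fintype.card_fin,
    Nat.add_sub_cancel, Finset.mul_sum]
  refine Finset.sum_congr rfl fun j hj => ?_
  rw [nsmul_eq_mul, Nat.cast_choose ℝ (Finset.mem_range_succ_iff.1 hj)]
  field_simp

lemma sum_weight_idle (i : Fin (n + 1)) :
    ∑ B ∈ (Finset.univ.erase i).powerset,
      weight lam (Function.update (fun _ => m) i x) (Sum.inl B) =
    n.factorial * erlangNorm (n + 1) (lam / m) := by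
  have hweight : ∀ B ∈ (Finset.univ.erase i).powerset,
      weight lam (Function.update (fun _ => m) i x) (Sum.inl B) =
        ((n + 1 - B.card).factorial : ℝ) * (lam / m) ^ B.card := fun B hB => by
    rw [weight, prod_update_const (fun r => lam / r) hB, Finset.card_compl, Fintype.card_fin]
  rw [Finset.sum_congr rfl hweight, sum_powerset_erase_factorial, erlangNorm_succ]
  refine congrArg _ (Finset.sum_congr rfl fun j hj => ?_)
  have hjn := Finset.mem_range_succ_iff.1 hj
  rw [Nat.sub_add_comm hjn, Nat.factorial_succ]
  push_cast [hjn]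
  field_simp
  ring

lemma sum_weight_busy (i : Fin (n + 1)) :
    ∑ B ∈ (Finset.univ.erase i).powerset,
      weight lam (Function.update (fun _ => m) i x) (Sum.inl (insert i B)) =
    n.factorial * (lam / x * expSum (n + 1) (lam / m)) := by
  have hweight : ∀ B ∈ (Finset.univ.erase i).powerset,
      weight lam (Function.update (fun _ => m) i x) (Sum.inl (insert i B)) =
        lam / x * (((n + 0 - B.card).factorial : ℝ) * (lam / m) ^ B.card) := fun B hB => by
    have hi : i ∉ B := fun h => Finset.notMem_erase i _ (Finset.mem_powerset.1 hB h)
    rw [weight, Finset.prod_insert hi, prod_update_const (fun r => lam / r) hB, Finset.card_compl,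
      Fintype.card_fin, Finset.card_insert_of_notMem hi, Function.update_self,
      Nat.add_sub_add_right, add_zero]
    ring
  rw [Finset.sum_congr rfl hweight, ← Finset.mul_sum, sum_powerset_erase_factorial, mul_left_comm,
    expSum]
  simp [Nat.factorial_ne_zero]

lemma sum_update_const (i : Fin (n + 1)) :
    ∑ j, Function.update (fun _ : Fin (n + 1) => m) i x j = n * m + x := by
  rw [Finset.sum_update_of_mem (Finset.mem_univ i), Finset.sum_const,
    Finset.card_sdiff, Finset.inter_univ, Finset.card_singleton, Finset.card_univ,
    Fintype.card_fin, nsmul_eq_mul, Nat.add_sub_cancel, add_comm]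

lemma tsum_weight_update (hlam : 0 < lam) (hm : m ≠ 0) (hM : lam < n * m + x) (i : Fin (n + 1)) :
    ∑' t, weight lam (Function.update (fun _ => m) i x) t =
      n.factorial * (erlangNorm (n + 1) (lam / m) + lam / x * (expSum (n + 1) (lam / m) +
        (lam / m) ^ (n + 1) / n.factorial * (m / (n * m + x - lam)))) := by
  have hprod : ∏ j, lam / Function.update (fun _ : Fin (n + 1) => m) i x j =
      lam / x * (lam / m) ^ n := by
    rw [← Finset.mul_prod_erase _ _ (Finset.mem_univ i),
      prod_update_const (fun r => lam / r) (Finset.mem_powerset_self _),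
      Finset.card_erase_of_mem (Finset.mem_univ i), Function.update_self, Finset.card_univ,
      Fintype.card_fin, Nat.add_sub_cancel]
  have hsplit := Finset.sum_powerset_insert (Finset.notMem_erase i Finset.univ) fun B =>
    weight lam (Function.update (fun _ => m) i x) (Sum.inl B)
  rw [Finset.insert_erase (Finset.mem_univ i), Finset.powerset_univ, sum_weight_idle,
    sum_weight_busy] at hsplit
  rw [(hasSum_weight hlam (by rwa [sum_update_const])).tsum_eq, hsplit, hprod, sum_update_const,
    pow_succ]
  have htail : n.factorial * ((lam / m) ^ n * (lam / m) / n.factorial * (m / (n * m + x - lam))) =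
      (lam / m) ^ n * (lam / (n * m + x - lam)) := by
    field_simp
  linear_combination -(lam / x) * htail

end Deviation

/-- Idle time of a server who works at rate `x` while the others work at rate `m`, in terms of the
spare capacity `S` and the probability of waiting `C` of the symmetric system with rate `m`. -/
noncomputable def deviationIdle (lam m S C x : ℝ) : ℝ :=
  (1 + lam * m / x * ((1 - C) / S + C / (S + x - m)))⁻¹

lemma idleTime_update {N : ℕ} {lam m x : ℝ} (hlam : 0 < lam) (hm : 0 < m) (hx : 0 < x)
    (h : lam < N * m) (hM : lam < (N - 1) * m + x) (i : Fin N) :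
    idleTime lam (Function.update (fun _ => m) i x) i =
      deviationIdle lam m (N * m - lam) (erlangC N (lam / m)) x := by
  obtain ⟨n, rfl⟩ : ∃ n, N = n + 1 := ⟨N - 1, (Nat.sub_add_cancel i.pos).symm⟩
  have hpos : ∀ j, 0 < Function.update (fun _ : Fin (n + 1) => m) i x j := fun j => by
    rcases eq_or_ne j i with rfl | hj
    · rwa [Function.update_self]
    · rwa [Function.update_of_ne hj]
  have hρ : lam / m < (n + 1 : ℕ) := (div_lt_iff₀ hm).2 h
  have hρ₀ : 0 ≤ lam / m := by positivity
  have hA := erlangNorm_pos hρ₀ hρ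
  have hM' : lam < n * m + x := by simpa using hM
  have hS := (sub_pos.2 h).ne'
  have hload : ((n + 1 : ℕ) : ℝ) - lam / m = ((n + 1 : ℕ) * m - lam) / m := by field_simp
  have hother : ((n + 1 : ℕ) : ℝ) * m - lam + x - m = n * m + x - lam := by push_cast; ring
  rw [idleTime_eq_div hlam hpos (by rwa [sum_update_const]), sum_weight_idle,
    tsum_weight_update hlam hm.ne' hM', deviationIdle, one_sub_erlangC hρ₀ hρ, hload, hother,
    erlangC, mul_div_mul_left _ _ (by positivity), ← inv_div, Nat.add_sub_cancel]
  generalize ((n + 1 : ℕ) : ℝ) * m - lam = S at hS ⊢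
  field_simp

/-- The derivative of `deviationIdle lam m S C` at `m`. -/
noncomputable def marginalIdle (lam m S C : ℝ) : ℝ := lam / (S + lam) ^ 2 * (S / m + C)

section Tangent

variable {lam m S C x : ℝ}

lemma hasDerivAt_deviationIdle (hlam : 0 < lam) (hm : m ≠ 0) (hS : 0 < S) :
    HasDerivAt (deviationIdle lam m S C) (marginalIdle lam m S C) m := by
  have hload : HasDerivAt (fun x => lam * m / x) (-(lam * m) / m ^ 2) m := by
    simpa using (hasDerivAt_const m (lam * m)).fun_div (hasDerivAt_id m) hm
  have hspare : HasDerivAt (fun x => S + x - m) 1 m :=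
    ((hasDerivAt_id m).const_add S).sub_const m
  have hwait : HasDerivAt (fun x => (1 - C) / S + C / (S + x - m)) (-C / S ^ 2) m := by
    simpa using ((hasDerivAt_const m C).fun_div hspare (by simpa using hS.ne')).const_add
      ((1 - C) / S)
  have hval : 1 + lam * m / m * ((1 - C) / S + C / (S + m - m)) = (S + lam) / S := by
    rw [add_sub_cancel_right]
    field_simp
    ring
  have hne : 1 + lam * m / m * ((1 - C) / S + C / (S + m - m)) ≠ 0 := by
    rw [hval]
    positivity
  refine (((hload.fun_mul hwait).const_add 1).fun_inv hne).congr_deriv ?_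
  rw [hval, add_sub_cancel_right, marginalIdle]
  field_simp
  ring

lemma deviationIdle_le_tangent (hlam : 0 < lam) (hm : 0 < m) (hx : 0 < x) (hy : 0 < S + x - m)
    (hC₀ : 0 ≤ C) (hC₁ : C ≤ 1) (hmS : m ≤ S) (hCS : lam * m * C ≤ S ^ 2) :
    deviationIdle lam m S C x ≤
      deviationIdle lam m S C m + marginalIdle lam m S C * (x - m) := by
  have hS : 0 < S := hm.trans_le hmS
  set R := x * (S + x - m) * S + lam * m * ((1 - C) * (S + x - m) + C * S) with hR_def
  have hC₁' : 0 ≤ 1 - C := sub_nonneg.2 hC₁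
  have hR : 0 < R := by positivity
  have hself : deviationIdle lam m S C m = S / (S + lam) := by
    rw [deviationIdle, add_sub_cancel_right, ← inv_div]
    field_simp
    ring
  have hgap : deviationIdle lam m S C m + marginalIdle lam m S C * (x - m) -
      deviationIdle lam m S C x =
      lam * (x - m) ^ 2 * ((S - (1 - C) * m) * (S ^ 2 - lam * m * C) + x * S * (S + C * m)) /
        (R * m * (S + lam) ^ 2) := by
    have hinv : deviationIdle lam m S C x = x * (S + x - m) * S / R := by
      rw [deviationIdle, ← inv_div, hR_def]
      field_simp
    rw [hself, hinv, marginalIdle]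
    field_simp
    rw [hR_def]
    ring
  have hspare : 0 ≤ S - (1 - C) * m := by nlinarith
  have hcap : 0 ≤ S ^ 2 - lam * m * C := sub_nonneg.2 hCS
  rw [← sub_nonneg, hgap]
  exact div_nonneg (mul_nonneg (by positivity)
    (add_nonneg (mul_nonneg hspare hcap) (by positivity))) (by positivity)

end Tangent

/-! ### Convex effort costs -/

/-- Effort costs without conditions on the second and third derivatives: strictly increasing, convex
and differentiable for positive service rates. -/
structure IsConvexEffortCost (c : ℝ → ℝ) : Prop where
  strictMono : StrictMonoOn c (Set.Ioi 0)
  convex : ConvexOn ℝ (Set.Ioi 0) c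
  differentiable : ∀ x ∈ Set.Ioi (0 : ℝ), DifferentiableAt ℝ c x

lemma IsEffortCost.isConvexEffortCost {c : ℝ → ℝ} (hc : IsEffortCost c) :
    IsConvexEffortCost c where
  strictMono := hc.strictMono
  convex := hc.convex
  differentiable x hx := by simpa using hc.differentiable 0 three_pos x hx

lemma continuousOn_of_monotoneOn_of_ordConnected_image {α β : Type*}
    [LinearOrder α] [TopologicalSpace α] [OrderTopology α]
    [LinearOrder β] [TopologicalSpace β] [OrderTopology β] [DenselyOrdered β]
    {f : α → β} {s : Set α} (hf : MonotoneOn f s) (hs : (f '' s).OrdConnected) :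
    ContinuousOn f s := by
  refine fun x hx => tendsto_order.2 ⟨fun b hb => ?_, fun b hb => ?_⟩
  · by_cases h : ∃ y ∈ s, f y ≤ b
    · obtain ⟨y, hy, hyb⟩ := h
      obtain ⟨b', hbb', hb'⟩ := exists_between hb
      obtain ⟨z, hz, rfl⟩ := hs.out ⟨y, hy, rfl⟩ ⟨x, hx, rfl⟩ ⟨hyb.trans hbb'.le, hb'.le⟩
      have hzx : z < x := not_le.1 fun h => hb'.not_ge (hf hx hz h)
      filter_upwards [self_mem_nhdsWithin, mem_nhdsWithin_of_mem_nhds (lt_mem_nhds hzx)]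
        with t ht hzt
      exact hbb'.trans_le (hf hz ht hzt.le)
    · push Not at h
      exact eventually_nhdsWithin_of_forall h
  · by_cases h : ∃ y ∈ s, b ≤ f y
    · obtain ⟨y, hy, hyb⟩ := h
      obtain ⟨b', hb', hbb'⟩ := exists_between hb
      obtain ⟨z, hz, rfl⟩ := hs.out ⟨x, hx, rfl⟩ ⟨y, hy, rfl⟩ ⟨hb'.le, hbb'.le.trans hyb⟩
      have hzx : x < z := not_le.1 fun h => hb'.not_ge (hf hz hx h)
      filter_upwards [self_mem_nhdsWithin, mem_nhdsWithin_of_mem_nhds (gt_mem_nhds hzx)]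
        with t ht hzt
      exact (hf ht hz hzt.le).trans_lt hbb'
    · push Not at h
      exact eventually_nhdsWithin_of_forall h

lemma add_deriv_mul_sub_le_of_convexOn {s : Set ℝ} {f : ℝ → ℝ} (hf : ConvexOn ℝ s f) {x y : ℝ}
    (hx : x ∈ s) (hy : y ∈ s) (hfx : DifferentiableAt ℝ f x) :
    f x + deriv f x * (y - x) ≤ f y := by
  rcases lt_trichotomy x y with h | rfl | h
  · have := hf.deriv_le_slope hx hy h hfx
    rw [slope_def_field, le_div_iff₀ (sub_pos.2 h)] at this
    linarith
  · simp
  · have := hf.slope_le_deriv hy hx h hfx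
    rw [slope_def_field, div_le_iff₀ (sub_pos.2 h)] at this
    linarith

section EffortCost

variable {c : ℝ → ℝ}

lemma IsConvexEffortCost.monotoneOn_deriv (hc : IsConvexEffortCost c) :
    MonotoneOn (deriv c) (Set.Ioi 0) :=
  hc.convex.monotoneOn_deriv hc.differentiable

lemma IsConvexEffortCost.continuousOn_deriv (hc : IsConvexEffortCost c) :
    ContinuousOn (deriv c) (Set.Ioi 0) :=
  continuousOn_of_monotoneOn_of_ordConnected_image hc.monotoneOn_deriv
    (Set.ordConnected_Ioi.image_deriv hc.differentiable)

lemma IsConvexEffortCost.deriv_pos (hc : IsConvexEffortCost c) {x : ℝ} (hx : 0 < x) :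
    0 < deriv c x := by
  have htangent := add_deriv_mul_sub_le_of_convexOn hc.convex hx (half_pos hx)
    (hc.differentiable x hx)
  have hlt := hc.strictMono (half_pos hx) hx (half_lt_self hx)
  nlinarith

end EffortCost

/-! ### The first order condition -/

section Equilibrium

variable {c : ℝ → ℝ} {lam m x : ℝ} {N : ℕ}

lemma pos_of_lt_mul (hlam : 0 < lam) (h : lam < N * m) : 0 < (N : ℝ) ∧ 0 < m := by
  have hm : 0 < m := pos_of_mul_pos_right (hlam.trans h) N.cast_nonneg
  exact ⟨pos_of_mul_pos_left (hlam.trans h) hm.le, hm⟩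

lemma lt_sub_one_mul_add (hN : 1 ≤ (N : ℝ)) (h : lam < N * m) (hx : lam < N * x) :
    lam < (N - 1) * m + x := by
  nlinarith

lemma utility_update (hlam : 0 < lam) (h : lam < N * m) (hx : lam < N * x) (i : Fin N) :
    utility c lam (Function.update (fun _ => m) i x) i =
      deviationIdle lam m (N * m - lam) (erlangC N (lam / m)) x - c x := by
  have hN : 1 ≤ (N : ℝ) := by exact_mod_cast i.pos
  rw [utility, Function.update_self, idleTime_update hlam (pos_of_lt_mul hlam h).2
    (pos_of_lt_mul hlam hx).2 h (lt_sub_one_mul_add hN h hx)]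

lemma utility_const (hlam : 0 < lam) (h : lam < N * m) (i : Fin N) :
    utility c lam (fun _ => m) i =
      deviationIdle lam m (N * m - lam) (erlangC N (lam / m)) m - c m := by
  rw [← utility_update hlam h h i, Function.update_eq_self]

lemma IsSymmetricEquilibrium.deriv_eq (hlam : 0 < lam) (h : IsSymmetricEquilibrium c lam N m)
    (hc : DifferentiableAt ℝ c m) :
    deriv c m = marginalIdle lam m (N * m - lam) (erlangC N (lam / m)) := by
  obtain ⟨hN, hm⟩ := pos_of_lt_mul hlam h.1
  have hmax : IsLocalMax
      (fun x => deviationIdle lam m (N * m - lam) (erlangC N (lam / m)) x - c x) m := by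
    filter_upwards [lt_mem_nhds ((div_lt_iff₀' hN).2 h.1)] with x hx
    have hNx := (div_lt_iff₀' hN).1 hx
    have := h.2.2 ⟨0, by exact_mod_cast hN⟩ x hNx
    rwa [utility_update hlam h.1 hNx, utility_const hlam h.1] at this
  have := hmax.hasDerivAt_eq_zero
    ((hasDerivAt_deviationIdle hlam hm.ne' (sub_pos.2 h.1)).sub hc.hasDerivAt)
  linarith

lemma isSymmetricEquilibrium_of_deriv_eq (hc : IsConvexEffortCost c) (hlam : 0 < lam)
    (h : lam < N * m) (hmS : m ≤ N * m - lam)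
    (hCS : lam * m * erlangC N (lam / m) ≤ (N * m - lam) ^ 2)
    (hderiv : deriv c m = marginalIdle lam m (N * m - lam) (erlangC N (lam / m))) :
    IsSymmetricEquilibrium c lam N m := by
  obtain ⟨-, hm⟩ := pos_of_lt_mul hlam h
  have hρ : lam / m < N := (div_lt_iff₀ hm).2 h
  have hρ₀ : 0 ≤ lam / m := by positivity
  refine ⟨h, fun _ => h, fun i x hNx => ?_⟩
  obtain ⟨-, hx⟩ := pos_of_lt_mul hlam hNx
  have hN : 1 ≤ (N : ℝ) := by exact_mod_cast i.pos
  have hidle := deviationIdle_le_tangent hlam hm hx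
    (by linarith [lt_sub_one_mul_add hN h hNx] : 0 < N * m - lam + x - m)
    (erlangC_nonneg hρ₀ hρ) (erlangC_le_one hρ₀ hρ) hmS hCS
  have hcost := add_deriv_mul_sub_le_of_convexOn hc.convex hm hx (hc.differentiable m hm)
  rw [utility_update hlam h hNx, utility_const hlam h]
  rw [hderiv] at hcost
  linarith

end Equilibrium

/-! ### The limiting equilibrium equation -/

/-- The defect, right side minus left side, in the limiting equilibrium equation that defines
`solvableSet`, multiplied by `a ^ 2`. -/
noncomputable def limitGap (c : ℝ → ℝ) (a m : ℝ) : ℝ := a ^ 2 / m - a + m ^ 2 * deriv c m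

section LimitGap

variable {c : ℝ → ℝ} {a m : ℝ}

lemma limitGap_eq_zero_iff (ha : a ≠ 0) (hm : m ≠ 0) :
    limitGap c a m = 0 ↔ 1 / a - 1 / m = m ^ 2 / a ^ 2 * deriv c m := by
  have hgap : a ^ 2 * (m ^ 2 / a ^ 2 * deriv c m - (1 / a - 1 / m)) = limitGap c a m := by
    rw [limitGap]
    field_simp
    ring
  rw [← hgap, mul_eq_zero, or_iff_right (pow_ne_zero 2 ha), sub_eq_zero, eq_comm]

lemma mem_solvableSet_iff : a ∈ solvableSet c ↔ 0 < a ∧ ∃ m, 0 < m ∧ limitGap c a m = 0 :=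
  and_congr_right fun ha => exists_congr fun _ => and_congr_right fun hm =>
    (limitGap_eq_zero_iff ha.ne' hm.ne').symm

lemma limitGap_self (ha : a ≠ 0) : limitGap c a a = a ^ 2 * deriv c a := by
  rw [limitGap]
  field_simp
  ring

lemma limitGap_sub_left (hm : m ≠ 0) : limitGap c (m - a) m = limitGap c a m := by
  rw [limitGap, limitGap]
  field_simp
  ring

lemma limitGap_eq_mul_sq_add (hm : m ≠ 0) :
    limitGap c a m = m * ((a / m - 1 / 2) ^ 2 + (m * deriv c m - 1 / 4)) := by
  rw [limitGap]
  field_simp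
  ring

lemma lt_of_limitGap_nonpos (hc : IsConvexEffortCost c) (ha : 0 < a) (hm : 0 < m)
    (h : limitGap c a m ≤ 0) : a < m := by
  have hcost : 0 < m ^ 2 * deriv c m := mul_pos (by positivity) (hc.deriv_pos hm)
  have hlt : a ^ 2 / m < a := by rw [limitGap] at h; linarith
  rw [div_lt_iff₀ hm, sq] at hlt
  exact lt_of_mul_lt_mul_left hlt ha.le

lemma continuousOn_limitGap (hc : IsConvexEffortCost c) :
    ContinuousOn (fun z : ℝ × ℝ => limitGap c z.1 z.2) (Set.univ ×ˢ Set.Ioi 0) := by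
  have hderiv : ContinuousOn (fun z : ℝ × ℝ => deriv c z.2) (Set.univ ×ˢ Set.Ioi 0) :=
    hc.continuousOn_deriv.comp continuousOn_snd fun z hz => hz.2
  have hdiv : ContinuousOn (fun z : ℝ × ℝ => z.1 ^ 2 / z.2) (Set.univ ×ˢ Set.Ioi 0) :=
    ContinuousOn.div (by fun_prop) continuousOn_snd fun z hz => (Set.mem_Ioi.1 hz.2).ne'
  exact (hdiv.sub continuousOn_fst).add ((continuousOn_snd.pow 2).mul hderiv)

lemma continuousOn_limitGap_right (hc : IsConvexEffortCost c) (a : ℝ) :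
    ContinuousOn (limitGap c a) (Set.Ioi 0) :=
  (continuousOn_limitGap hc).comp (f := fun m => (a, m)) (by fun_prop) fun _ hm =>
    ⟨Set.mem_univ _, hm⟩

lemma mem_solvableSet_of_limitGap_nonpos (hc : IsConvexEffortCost c) (ha : 0 < a) (hm : 0 < m)
    (h : limitGap c a m ≤ 0) : a ∈ solvableSet c := by
  have hlt := lt_of_limitGap_nonpos hc ha hm h
  have hself : 0 ≤ limitGap c a a := by
    rw [limitGap_self ha.ne']
    exact mul_nonneg (by positivity) (hc.deriv_pos ha).le
  obtain ⟨x, hx, hroot⟩ := intermediate_value_Icc' hlt.le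
    ((continuousOn_limitGap_right hc a).mono fun y hy => ha.trans_le hy.1) ⟨h, hself⟩
  exact mem_solvableSet_iff.2 ⟨ha, x, ha.trans_le hx.1, hroot⟩

lemma le_of_mul_deriv_le (hc : IsConvexEffortCost c) (hm : 0 < m) {b : ℝ} (hb : 0 ≤ b)
    (h : m * deriv c m ≤ b) : m ≤ 1 + b / deriv c 1 := by
  have hc₁ := hc.deriv_pos one_pos
  rcases le_total m 1 with hm₁ | hm₁
  · exact hm₁.trans (le_add_of_nonneg_right (by positivity))
  · have : m ≤ b / deriv c 1 := (le_div_iff₀ hc₁).2 <|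
      (mul_le_mul_of_nonneg_left (hc.monotoneOn_deriv (Set.mem_Ioi.2 one_pos) hm hm₁) hm.le).trans h
    linarith

lemma le_of_limitGap_nonpos (hc : IsConvexEffortCost c) (hm : 0 < m)
    (h : limitGap c a m ≤ 0) : m ≤ 1 + 1 / deriv c 1 := by
  refine le_of_mul_deriv_le hc hm zero_le_one ?_
  rw [limitGap_eq_mul_sq_add hm.ne'] at h
  linarith [nonpos_of_mul_nonpos_right h hm, sq_nonneg (a / m - 1 / 2)]

lemma nonempty_solvableSet (hc : IsConvexEffortCost c) : (solvableSet c).Nonempty := by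
  have hc₁ := hc.deriv_pos one_pos
  set m := min 1 (1 / (4 * deriv c 1))
  have hm : 0 < m := lt_min one_pos (by positivity)
  have hcost : m * deriv c m ≤ 1 / 4 :=
    calc m * deriv c m ≤ 1 / (4 * deriv c 1) * deriv c 1 :=
          mul_le_mul (min_le_right _ _)
            (hc.monotoneOn_deriv hm (Set.mem_Ioi.2 one_pos) (min_le_left _ _))
            (hc.deriv_pos hm).le (by positivity)
      _ = 1 / 4 := by field_simp
  refine ⟨m / 2, mem_solvableSet_of_limitGap_nonpos hc (half_pos hm) hm ?_⟩
  rw [limitGap_eq_mul_sq_add hm.ne', div_div_cancel_left' hm.ne']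
  exact mul_nonpos_of_nonneg_of_nonpos hm.le (by linarith)

lemma isGreatest_aStar (hc : IsConvexEffortCost c) : IsGreatest (solvableSet c) (aStar c) := by
  suffices h : ∃ a, IsGreatest (solvableSet c) a by
    obtain ⟨a, ha⟩ := h
    rwa [aStar, ha.csSup_eq]
  obtain ⟨a₀, ha₀⟩ := nonempty_solvableSet hc
  set box : Set (ℝ × ℝ) :=
    Set.Icc a₀ (1 + 1 / deriv c 1) ×ˢ Set.Icc a₀ (1 + 1 / deriv c 1)
  set T := box ∩ (fun z => limitGap c z.1 z.2) ⁻¹' Set.Iic 0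
  have hbox : IsCompact box := isCompact_Icc.prod isCompact_Icc
  have hcont : ContinuousOn (fun z : ℝ × ℝ => limitGap c z.1 z.2) box :=
    (continuousOn_limitGap hc).mono fun z hz => ⟨Set.mem_univ _, ha₀.1.trans_le hz.2.1⟩
  have hT : IsCompact T := hbox.of_isClosed_subset
    (hcont.preimage_isClosed_of_isClosed hbox.isClosed isClosed_Iic) Set.inter_subset_left
  have hmem : ∀ a ∈ solvableSet c, a₀ ≤ a → ∃ m, (a, m) ∈ T := by
    intro a haS hle
    obtain ⟨ha, m, hm, h⟩ := mem_solvableSet_iff.1 haS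
    have ham := (lt_of_limitGap_nonpos hc ha hm h.le).le
    have hmK := le_of_limitGap_nonpos hc hm h.le
    exact ⟨m, ⟨⟨hle, ham.trans hmK⟩, hle.trans ham, hmK⟩, h.le⟩
  obtain ⟨m₀, hm₀⟩ := hmem a₀ ha₀ le_rfl
  obtain ⟨⟨a, m⟩, ⟨⟨⟨ha, -⟩, hm, -⟩, hgap⟩, hmax⟩ :=
    hT.exists_isMaxOn ⟨_, hm₀⟩ continuous_fst.continuousOn
  refine ⟨a, mem_solvableSet_of_limitGap_nonpos hc (ha₀.1.trans_le ha) (ha₀.1.trans_le hm) hgap,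
    fun b hb => ?_⟩
  rcases le_total a₀ b with hle | hle
  · obtain ⟨m', hm'⟩ := hmem b hb hle
    exact hmax hm'
  · exact hle.trans ha

lemma aStar_pos (hc : IsConvexEffortCost c) : 0 < aStar c := (isGreatest_aStar hc).1.1

lemma le_aStar_of_limitGap_nonpos (hc : IsConvexEffortCost c) (ha : 0 < a) (hm : 0 < m)
    (h : limitGap c a m ≤ 0) : a ≤ aStar c :=
  (isGreatest_aStar hc).2 (mem_solvableSet_of_limitGap_nonpos hc ha hm h)

-- At `m = 2 * a` the gap is `m * (m * deriv c m - 1 / 4)`; when it vanishes, monotonicity of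
-- `deriv c` makes the gap nonpositive at the rate `3 / 4 * m` for the larger `9 / 16 * m`.
lemma half_lt_aStar_of_limitGap_half_eq_zero (hc : IsConvexEffortCost c) (hm : 0 < m)
    (h : limitGap c (m / 2) m = 0) : m / 2 < aStar c := by
  have hcost : m * deriv c m = 1 / 4 := by
    rw [limitGap_eq_mul_sq_add hm.ne', div_div_cancel_left' hm.ne'] at h
    linarith [(mul_eq_zero.1 h).resolve_left hm.ne']
  have hm' : 0 < 3 / 4 * m := by linarith
  have hmono : m * deriv c (3 / 4 * m) ≤ 1 / 4 :=
    (mul_le_mul_of_nonneg_left (hc.monotoneOn_deriv hm' hm (by linarith)) hm.le).trans_eq hcost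
  have hgap : limitGap c (9 / 16 * m) (3 / 4 * m) =
      9 / 16 * m * (m * deriv c (3 / 4 * m) - 1 / 4) := by
    rw [limitGap]
    field_simp
    ring
  have hle : 9 / 16 * m ≤ aStar c := le_aStar_of_limitGap_nonpos hc (by linarith) hm' <|
    hgap.trans_le (mul_nonpos_of_nonneg_of_nonpos (by linarith) (by linarith))
  linarith

lemma exists_limitGap_aStar_eq_zero (hc : IsConvexEffortCost c) :
    ∃ m, aStar c < m ∧ m < 2 * aStar c ∧ limitGap c (aStar c) m = 0 := by
  obtain ⟨ha, m, hm, h⟩ := mem_solvableSet_iff.1 (isGreatest_aStar hc).1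
  refine ⟨m, lt_of_limitGap_nonpos hc ha hm h.le, ?_, h⟩
  by_contra! hle
  rcases hle.lt_or_eq with hlt | heq
  · have := le_aStar_of_limitGap_nonpos hc (a := m - aStar c) (by linarith) hm
      ((limitGap_sub_left hm.ne').trans h).le
    linarith
  · have ha' : aStar c = m / 2 := by linarith
    rw [ha'] at h
    linarith [half_lt_aStar_of_limitGap_half_eq_zero hc hm h]

lemma exists_pos_forall_le_limitGap (hc : IsConvexEffortCost c) {b : ℝ} (hb : aStar c < b)
    (K : ℝ) : ∃ η, 0 < η ∧ ∀ a m, b ≤ a → a ≤ m → m ≤ K → η ≤ limitGap c a m := by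
  have hb₀ := (aStar_pos hc).trans hb
  have hcont : ContinuousOn (fun z : ℝ × ℝ => limitGap c z.1 z.2) (Set.Icc b K ×ˢ Set.Icc b K) :=
    (continuousOn_limitGap hc).mono fun z hz => ⟨Set.mem_univ _, hb₀.trans_le hz.2.1⟩
  obtain ⟨η, hη, hle⟩ := (isCompact_Icc.prod isCompact_Icc).exists_forall_le' hcont (a := 0)
    fun z hz => not_le.1 fun h => (hb.trans_le hz.1.1).not_ge <|
      le_aStar_of_limitGap_nonpos hc (hb₀.trans_le hz.1.1) (hb₀.trans_le hz.2.1) h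
  exact ⟨η, hη, fun a m hba ham hmK => hle (a, m) ⟨⟨hba, ham.trans hmK⟩, hba.trans ham, hmK⟩⟩

end LimitGap

/-! ### Equilibria for large arrival rates -/

section Equilibria

variable {c : ℝ → ℝ} {lam m : ℝ} {N : ℕ}

lemma deriv_eq_marginalIdle_iff (hN : (N : ℝ) ≠ 0) (hm : m ≠ 0) (C : ℝ) :
    deriv c m = marginalIdle lam m (N * m - lam) C ↔
      limitGap c (lam / N) m = (lam / N) ^ 2 / lam * C := by
  have h : limitGap c (lam / N) m - (lam / N) ^ 2 / lam * C =
      m ^ 2 * (deriv c m - marginalIdle lam m (N * m - lam) C) := by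
    rw [limitGap, marginalIdle, sub_add_cancel]
    field_simp
    ring
  rw [← sub_eq_zero, ← sub_eq_zero (a := limitGap c (lam / N) m), h, mul_eq_zero,
    or_iff_right (pow_ne_zero 2 hm)]

lemma IsSymmetricEquilibrium.div_lt (hlam : 0 < lam) (h : IsSymmetricEquilibrium c lam N m) :
    lam / N < m :=
  (div_lt_iff₀' (pos_of_lt_mul hlam h.1).1).2 h.1

lemma IsSymmetricEquilibrium.limitGap_le (hlam : 0 < lam) (h : IsSymmetricEquilibrium c lam N m)
    (hc : DifferentiableAt ℝ c m) : limitGap c (lam / N) m ≤ (lam / N) ^ 2 / lam := by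
  obtain ⟨hN, hm⟩ := pos_of_lt_mul hlam h.1
  rw [(deriv_eq_marginalIdle_iff hN.ne' hm.ne' _).1 (h.deriv_eq hlam hc)]
  exact mul_le_of_le_one_right (by positivity)
    (erlangC_le_one (by positivity) ((div_lt_iff₀ hm).2 h.1))

lemma sq_div_le_div (hlam : 0 < lam) (hN : 0 < (N : ℝ)) : (lam / N) ^ 2 / lam ≤ lam / N := by
  have hN₁ : 1 ≤ (N : ℝ) := by exact_mod_cast hN
  rw [div_le_iff₀ hlam, sq]
  exact mul_le_mul_of_nonneg_left (div_le_self hlam.le hN₁) (by positivity)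

lemma IsSymmetricEquilibrium.le_bound (hc : IsConvexEffortCost c) (hlam : 0 < lam)
    (h : IsSymmetricEquilibrium c lam N m) : m ≤ 1 + 2 / deriv c 1 := by
  obtain ⟨hN, hm⟩ := pos_of_lt_mul hlam h.1
  refine le_of_mul_deriv_le hc hm zero_le_two (le_of_mul_le_mul_left ?_ hm)
  have hgap := h.limitGap_le hlam (hc.differentiable m hm)
  have hterm : 0 ≤ (lam / N) ^ 2 / m := by positivity
  rw [limitGap] at hgap
  linarith [sq_div_le_div hlam hN, h.div_lt hlam]

lemma IsSymmetricEquilibrium.le_largestEquilibrium (hc : IsConvexEffortCost c) (hlam : 0 < lam)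
    (h : IsSymmetricEquilibrium c lam N m) : m ≤ largestEquilibrium c lam N :=
  le_csSup ⟨_, fun _ h' => IsSymmetricEquilibrium.le_bound hc hlam h'⟩ h

lemma admissible_iff (hc : IsConvexEffortCost c) {P : ℝ → ℕ} :
    Admissible c P ↔ ∀ᶠ lam in atTop, ∃ m, IsSymmetricEquilibrium c lam (P lam) m := by
  refine ⟨fun h => h.1, fun h => ⟨h, ?_⟩⟩
  choose! m hm using fun lam (h : ∃ m, IsSymmetricEquilibrium c lam (P lam) m) => h
  refine ⟨m, h.mono hm, 1 + 2 / deriv c 1, eventually_map.2 ?_⟩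
  filter_upwards [h, eventually_gt_atTop 0] with lam hex hlam
  exact (hm lam hex).le_bound hc hlam

lemma eventually_div_lt_of_aStar_lt (hc : IsConvexEffortCost c) {b : ℝ} (hb : aStar c < b) :
    ∀ᶠ lam : ℝ in atTop, ∀ (N : ℕ) (m : ℝ), IsSymmetricEquilibrium c lam N m → lam / N < b := by
  set K := 1 + 2 / deriv c 1
  obtain ⟨η, hη, hmin⟩ := exists_pos_forall_le_limitGap hc hb K
  filter_upwards [eventually_gt_atTop 0, eventually_gt_atTop (K ^ 2 / η)] with lam hlam hlarge N m h
  by_contra! hle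
  have hlt := h.div_lt hlam
  have hmK := h.le_bound hc hlam
  have hsmall : (lam / N) ^ 2 / lam < η :=
    calc (lam / N) ^ 2 / lam ≤ K ^ 2 / lam := by gcongr; exact hlt.le.trans hmK
      _ < η := (div_lt_comm₀ hη hlam).1 hlarge
  exact (hmin _ m hle hlt.le hmK).not_gt <|
    (h.limitGap_le hlam (hc.differentiable m (pos_of_lt_mul hlam h.1).2)).trans_lt hsmall

lemma eventually_lt_div_of_lt_one_div_aStar (hc : IsConvexEffortCost c) {b : ℝ}
    (hb : b < 1 / aStar c) :
    ∀ᶠ lam : ℝ in atTop, ∀ (N : ℕ) (m : ℝ), IsSymmetricEquilibrium c lam N m → b < N / lam := by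
  have ha := aStar_pos hc
  obtain ⟨d, hbd, hd⟩ := exists_between (max_lt hb (one_div_pos.2 ha))
  have hd₀ : 0 < d := (le_max_right _ _).trans_lt hbd
  filter_upwards [eventually_div_lt_of_aStar_lt hc ((lt_one_div hd₀ ha).1 hd),
    eventually_gt_atTop 0] with lam hlt hlam N m h
  have hN := (pos_of_lt_mul hlam h.1).1
  have hdN : d < 1 / (lam / N) := (lt_one_div (by positivity) hd₀).1 (hlt N m h)
  rw [one_div_div] at hdN
  exact ((le_max_left _ _).trans_lt hbd).trans hdN

lemma IsSymmetricEquilibrium.div_add_mul_deriv_le (hc : IsConvexEffortCost c) (hlam : 0 < lam)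
    (h : IsSymmetricEquilibrium c lam N m) :
    lam / m + lam * deriv c (lam / N) ≤ N + 1 := by
  obtain ⟨hN, hm⟩ := pos_of_lt_mul hlam h.1
  have hlt := h.div_lt hlam
  have ha : 0 < lam / N := by positivity
  have hcost : (lam / N) ^ 2 * deriv c (lam / N) ≤ m ^ 2 * deriv c m :=
    mul_le_mul (pow_le_pow_left₀ ha.le hlt.le 2) (hc.monotoneOn_deriv ha hm hlt.le)
      (hc.deriv_pos ha).le (by positivity)
  have hgap := h.limitGap_le hlam (hc.differentiable m hm)
  rw [limitGap] at hgap
  have hscaled : (lam / N) ^ 2 / m + (lam / N) ^ 2 * deriv c (lam / N) ≤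
      lam / N + (lam / N) ^ 2 / lam := by linarith
  calc lam / m + lam * deriv c (lam / N)
      = N ^ 2 / lam * ((lam / N) ^ 2 / m + (lam / N) ^ 2 * deriv c (lam / N)) := by field_simp
    _ ≤ N ^ 2 / lam * (lam / N + (lam / N) ^ 2 / lam) := by gcongr
    _ = N + 1 := by field_simp

lemma exists_deriv_eq_marginalIdle (hc : IsConvexEffortCost c) (hlam : 0 < lam) {m₀ K : ℝ}
    (h : lam < N * m₀) (hgap : limitGap c (lam / N) m₀ ≤ 0) (hK : m₀ ≤ K)
    (hKc : 2 ≤ K * deriv c K) : ∃ m ∈ Set.Icc m₀ K,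
      deriv c m = marginalIdle lam m (N * m - lam) (erlangC N (lam / m)) := by
  obtain ⟨hN, hm₀⟩ := pos_of_lt_mul hlam h
  have hpos : ∀ x ∈ Set.Icc m₀ K, 0 < x := fun x hx => hm₀.trans_le hx.1
  have hload : ∀ x ∈ Set.Icc m₀ K, lam / x ∈ Set.Ico 0 (N : ℝ) := fun x hx =>
    have hx₀ := hpos x hx
    ⟨by positivity, (div_lt_iff₀ hx₀).2 (h.trans_le (mul_le_mul_of_nonneg_left hx.1 hN.le))⟩
  have hcont : ContinuousOn (fun x => (lam / N) ^ 2 / lam * erlangC N (lam / x))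
      (Set.Icc m₀ K) :=
    continuousOn_const.mul <| (continuousOn_erlangC N).comp
      (continuousOn_const.div continuousOn_id fun x hx => (hpos x hx).ne') hload
  have hleft : limitGap c (lam / N) m₀ ≤ (lam / N) ^ 2 / lam * erlangC N (lam / m₀) :=
    have hload₀ := hload m₀ (Set.left_mem_Icc.2 hK)
    hgap.trans (mul_nonneg (by positivity) (erlangC_nonneg hload₀.1 hload₀.2))
  have hright : (lam / N) ^ 2 / lam * erlangC N (lam / K) ≤ limitGap c (lam / N) K := by
    have hloadK := hload K (Set.right_mem_Icc.2 hK)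
    have hK₀ := hm₀.trans_le hK
    have haK : lam / N ≤ K := ((div_lt_iff₀' hN).2 h).le.trans hK
    have hwait : (lam / N) ^ 2 / lam * erlangC N (lam / K) ≤ lam / N :=
      (mul_le_of_le_one_right (by positivity) (erlangC_le_one hloadK.1 hloadK.2)).trans
        (sq_div_le_div hlam hN)
    have hterm : 0 ≤ (lam / N) ^ 2 / K := by positivity
    have hcost := mul_le_mul_of_nonneg_left hKc hK₀.le
    rw [limitGap]
    linarith
  obtain ⟨x, hx, hroot⟩ := isPreconnected_Icc.intermediate_value₂ (Set.left_mem_Icc.2 hK)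
    (Set.right_mem_Icc.2 hK) ((continuousOn_limitGap_right hc _).mono hpos) hcont hleft hright
  exact ⟨x, hx,
    (deriv_eq_marginalIdle_iff hN.ne' (hpos x hx).ne' _).2 hroot⟩

lemma exists_isSymmetricEquilibrium (hc : IsConvexEffortCost c) (hlam : 0 < lam) {m₀ K : ℝ}
    (h : lam < N * m₀) (hgap : limitGap c (lam / N) m₀ ≤ 0) (hK : m₀ ≤ K)
    (hKc : 2 ≤ K * deriv c K) (hKS : K ≤ N * m₀ - lam) (hlamK : lam * K ≤ (N * m₀ - lam) ^ 2) :
    ∃ m, IsSymmetricEquilibrium c lam N m := by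
  obtain ⟨m, ⟨hm₀m, hmK⟩, hderiv⟩ := exists_deriv_eq_marginalIdle hc hlam h hgap hK hKc
  have hmono : N * m₀ - lam ≤ N * m - lam :=
    sub_le_sub_right (mul_le_mul_of_nonneg_left hm₀m N.cast_nonneg) lam
  have hlt : lam < N * m := by linarith
  have hm := (pos_of_lt_mul hlam hlt).2
  have hwait : lam * m * erlangC N (lam / m) ≤ (N * m - lam) ^ 2 :=
    calc lam * m * erlangC N (lam / m) ≤ lam * m :=
          mul_le_of_le_one_right (by positivity)
            (erlangC_le_one (by positivity) ((div_lt_iff₀ hm).2 hlt))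
      _ ≤ lam * K := mul_le_mul_of_nonneg_left hmK hlam.le
      _ ≤ (N * m₀ - lam) ^ 2 := hlamK
      _ ≤ (N * m - lam) ^ 2 := pow_le_pow_left₀ (sub_pos.2 h).le hmono 2
  exact ⟨m, isSymmetricEquilibrium_of_deriv_eq hc hlam hlt (hmK.trans (hKS.trans hmono)) hwait
    hderiv⟩

end Equilibria

/-! ### Policies with linear staffing -/

section Policies

variable {c : ℝ → ℝ} {P : ℝ → ℕ} {b : ℝ}

lemma tendsto_div_of_isLittleO
    (h : (fun lam : ℝ => (P lam : ℝ) - b * lam) =o[atTop] (fun lam : ℝ => lam)) :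
    Tendsto (fun lam : ℝ => (P lam : ℝ) / lam) atTop (𝓝 b) := by
  have hlim := h.tendsto_div_nhds_zero.add_const b
  rw [zero_add] at hlim
  refine hlim.congr' ?_
  filter_upwards [eventually_ne_atTop 0] with lam hlam
  rw [sub_div, mul_div_cancel_right₀ b hlam, sub_add_cancel]

lemma tendsto_atTop_of_tendsto_div (hb : 0 < b)
    (hP : Tendsto (fun lam : ℝ => (P lam : ℝ) / lam) atTop (𝓝 b)) :
    Tendsto (fun lam : ℝ => (P lam : ℝ)) atTop atTop := by
  refine (hP.pos_mul_atTop hb tendsto_id).congr' ?_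
  filter_upwards [eventually_ne_atTop 0] with lam hlam
  exact div_mul_cancel₀ _ hlam

lemma tendsto_inv_div (hb : b ≠ 0)
    (hP : Tendsto (fun lam : ℝ => (P lam : ℝ) / lam) atTop (𝓝 b)) :
    Tendsto (fun lam : ℝ => lam / P lam) atTop (𝓝 b⁻¹) := by
  simpa only [inv_div] using hP.inv₀ hb

lemma exists_le_mul_deriv (hc : IsConvexEffortCost c) (hb : 0 ≤ b) (x : ℝ) :
    ∃ K, x ≤ K ∧ b ≤ K * deriv c K := by
  have hc₁ := hc.deriv_pos one_pos
  refine ⟨max x (1 + b / deriv c 1), le_max_left _ _, ?_⟩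
  have hK : 1 + b / deriv c 1 ≤ max x (1 + b / deriv c 1) := le_max_right _ _
  have hb₁ : 0 ≤ b / deriv c 1 := by positivity
  have hK₁ : 1 ≤ max x (1 + b / deriv c 1) := by linarith
  calc b = b / deriv c 1 * deriv c 1 := (div_mul_cancel₀ _ hc₁.ne').symm
    _ ≤ _ := mul_le_mul (by linarith)
      (hc.monotoneOn_deriv (Set.mem_Ioi.2 one_pos) (one_pos.trans_le hK₁) hK₁) hc₁.le (by linarith)

lemma limitGap_nonpos_of_le {a a' m : ℝ} (hm : 0 < m) (h : limitGap c a' m ≤ 0) (hle : a ≤ a')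
    (hsub : m - a' ≤ a) : limitGap c a m ≤ 0 := by
  have hfactor : limitGap c a m = limitGap c a' m + (a - a') * (a - (m - a')) / m := by
    rw [limitGap, limitGap]
    field_simp
    ring
  have hprod : (a - a') * (a - (m - a')) / m ≤ 0 :=
    div_nonpos_of_nonpos_of_nonneg
      (mul_nonpos_of_nonpos_of_nonneg (sub_nonpos.2 hle) (sub_nonneg.2 hsub)) hm.le
  linarith

lemma admissible_of_div_aStar_le (hc : IsConvexEffortCost c)
    (hP : Tendsto (fun lam : ℝ => (P lam : ℝ) / lam) atTop (𝓝 (1 / aStar c)))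
    (hle : ∀ᶠ lam in atTop, lam / aStar c ≤ P lam) : Admissible c P := by
  have ha := aStar_pos hc
  obtain ⟨m₀, hm₀, hm₀', hgap⟩ := exists_limitGap_aStar_eq_zero hc
  obtain ⟨K, hK, hKc⟩ := exists_le_mul_deriv hc zero_le_two m₀
  have hK₀ : 0 < K := (ha.trans hm₀).trans_le hK
  have hd : 0 < m₀ - aStar c := sub_pos.2 hm₀
  have hinv : Tendsto (fun lam : ℝ => lam / P lam) atTop (𝓝 (aStar c)) := by
    simpa only [one_div, inv_inv] using tendsto_inv_div (one_div_pos.2 ha).ne' hP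
  have hPtop := tendsto_atTop_of_tendsto_div (one_div_pos.2 ha) hP
  refine (admissible_iff hc).2 ?_
  filter_upwards [hle, eventually_gt_atTop 0, hPtop.eventually_gt_atTop 0,
    hinv.eventually (lt_mem_nhds (sub_lt_iff_lt_add.2 (hm₀'.trans_eq (two_mul _)))),
    hPtop.eventually_ge_atTop (K / (m₀ - aStar c)),
    hPtop.eventually_ge_atTop (aStar c * K / (m₀ - aStar c) ^ 2)]
    with lam hlamP hlam hN hnear hPK hPK'
  have hlamP' : lam ≤ P lam * aStar c := (div_le_iff₀ ha).1 hlamP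
  have hspare : P lam * (m₀ - aStar c) ≤ P lam * m₀ - lam := by linarith
  have hspare₀ : 0 < P lam * (m₀ - aStar c) := mul_pos hN hd
  refine exists_isSymmetricEquilibrium hc hlam (by linarith)
    (limitGap_nonpos_of_le (ha.trans hm₀) hgap.le ((div_le_iff₀' hN).2 hlamP') hnear.le) hK hKc
    (((div_le_iff₀ hd).1 hPK).trans hspare) ?_
  calc lam * K ≤ P lam * aStar c * K := mul_le_mul_of_nonneg_right hlamP' hK₀.le
    _ = P lam * (aStar c * K) := mul_assoc _ _ _
    _ ≤ P lam * (P lam * (m₀ - aStar c) ^ 2) :=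
      mul_le_mul_of_nonneg_left ((div_le_iff₀ (by positivity)).1 hPK') hN.le
    _ = (P lam * (m₀ - aStar c)) ^ 2 := by ring
    _ ≤ (P lam * m₀ - lam) ^ 2 := pow_le_pow_left₀ hspare₀.le hspare 2

lemma qualityDriven_of_tendsto (hc : IsConvexEffortCost c) (hb : 0 < b)
    (hP : Tendsto (fun lam : ℝ => (P lam : ℝ) / lam) atTop (𝓝 b)) : QualityDriven c P := by
  have hbinv := inv_pos.2 hb
  have hd := hc.deriv_pos (half_pos hbinv)
  refine ⟨deriv c (b⁻¹ / 2) / 2, half_pos hd, ?_⟩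
  filter_upwards [eventually_gt_atTop 0,
    (tendsto_inv_div hb.ne' hP).eventually (lt_mem_nhds (half_lt_self hbinv)),
    eventually_ge_atTop (1 / (deriv c (b⁻¹ / 2) / 2))] with lam hlam hlt hlarge m h
  have hbound := h.div_add_mul_deriv_le hc hlam
  have hmono := mul_le_mul_of_nonneg_left
    (hc.monotoneOn_deriv (half_pos hbinv) ((half_pos hbinv).trans hlt) hlt.le) hlam.le
  have hone : 1 ≤ lam * (deriv c (b⁻¹ / 2) / 2) := (div_le_iff₀ (half_pos hd)).1 hlarge
  linarith

end Policies

/-! ### Costs -/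

section Cost

variable {c : ℝ → ℝ} {cS w lam m b : ℝ} {N : ℕ} {P : ℝ → ℕ}

lemma IsSymmetricEquilibrium.mul_le_totalCost (hc : IsConvexEffortCost c) (hw : 0 ≤ w)
    (hlam : 0 < lam) (h : IsSymmetricEquilibrium c lam N m) :
    cS * N ≤ totalCost c cS w lam N := by
  obtain ⟨hN, hm⟩ := pos_of_lt_mul hlam h.1
  have hle := h.le_largestEquilibrium hc hlam
  have hwait := meanWait_nonneg (mu := fun _ : Fin N => largestEquilibrium c lam N) hlam
    (fun _ => hm.trans_le hle)
    (by simpa using h.1.trans_le (mul_le_mul_of_nonneg_left hle hN.le))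
  exact le_add_of_nonneg_right (by positivity)

lemma IsSymmetricEquilibrium.totalCost_le (hc : IsConvexEffortCost c) (hw : 0 ≤ w)
    (hlam : 0 < lam) (h : IsSymmetricEquilibrium c lam N m) :
    totalCost c cS w lam N ≤ cS * N + w * lam * (1 / (N * m - lam)) := by
  obtain ⟨hN, hm⟩ := pos_of_lt_mul hlam h.1
  have hle := h.le_largestEquilibrium hc hlam
  have hNle : N * m ≤ N * largestEquilibrium c lam N := mul_le_mul_of_nonneg_left hle hN.le
  have hsum : ∑ _i : Fin N, largestEquilibrium c lam N = N * largestEquilibrium c lam N := by simp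
  have hwait := meanWait_le (mu := fun _ : Fin N => largestEquilibrium c lam N) hlam
    (fun _ => hm.trans_le hle) (hsum ▸ h.1.trans_le hNle)
  rw [hsum] at hwait
  have hspare := one_div_le_one_div_of_le (sub_pos.2 h.1) (sub_le_sub_right hNle lam)
  exact add_le_add_right
    (mul_le_mul_of_nonneg_left (hwait.trans hspare) (mul_nonneg hw hlam.le)) _

lemma tendsto_totalCost_div (hc : IsConvexEffortCost c) (hw : 0 ≤ w) (hadm : Admissible c P)
    (hP : Tendsto (fun lam : ℝ => (P lam : ℝ) / lam) atTop (𝓝 b)) (hQD : QualityDriven c P) :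
    Tendsto (fun lam : ℝ => totalCost c cS w lam (P lam) / lam) atTop (𝓝 (cS * b)) := by
  obtain ⟨δ, hδ, hspare⟩ := hQD
  have hlower : Tendsto (fun lam : ℝ => cS * ((P lam : ℝ) / lam)) atTop (𝓝 (cS * b)) :=
    hP.const_mul cS
  have hupper : Tendsto (fun lam : ℝ => cS * ((P lam : ℝ) / lam) +
      w / δ * ((P lam : ℝ) / lam) * lam⁻¹) atTop (𝓝 (cS * b)) := by
    simpa only [mul_zero, add_zero] using
      hlower.add ((hP.const_mul (w / δ)).mul tendsto_inv_atTop_zero)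
  refine tendsto_of_tendsto_of_tendsto_of_le_of_le' hlower hupper ?_ ?_
  · filter_upwards [eventually_gt_atTop 0, hadm.1] with lam hlam ⟨m, h⟩
    rw [← mul_div_assoc]
    exact div_le_div_of_nonneg_right (h.mul_le_totalCost hc hw hlam) hlam.le
  · filter_upwards [eventually_gt_atTop 0, hspare, hadm.1] with lam hlam hspare ⟨m, h⟩
    obtain ⟨hN, hm⟩ := pos_of_lt_mul hlam h.1
    have hcapacity : lam * (lam / P lam) * δ ≤ P lam * m - lam :=
      calc lam * (lam / P lam) * δ ≤ lam * m * δ := by gcongr; exact (h.div_lt hlam).le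
        _ = (lam / m + δ * lam) * m - lam := by field_simp; ring
        _ ≤ P lam * m - lam := by gcongr; exact hspare m h
    rw [div_le_iff₀ hlam]
    calc totalCost c cS w lam (P lam)
        ≤ cS * P lam + w * lam * (1 / (P lam * m - lam)) := h.totalCost_le hc hw hlam
      _ ≤ cS * P lam + w * lam * (1 / (lam * (lam / P lam) * δ)) := by gcongr
      _ = _ := by field_simp

end Cost

/-! ### Optimal policies -/

section OptimalPolicies

variable {c : ℝ → ℝ} {cS w : ℝ} {P : ℝ → ℕ}

/-- The policy that staffs `lam / aStar c` servers, rounded up; it witnesses admissibility and gives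
the upper bound on the optimal cost. -/
noncomputable def ceilPolicy (c : ℝ → ℝ) (lam : ℝ) : ℕ := ⌈lam / aStar c⌉₊

lemma tendsto_ceilPolicy (hc : IsConvexEffortCost c) :
    Tendsto (fun lam : ℝ => (ceilPolicy c lam : ℝ) / lam) atTop (𝓝 (1 / aStar c)) := by
  simpa only [ceilPolicy, one_div_mul_eq_div] using
    tendsto_nat_ceil_mul_div_atTop (one_div_pos.2 (aStar_pos hc)).le

lemma admissible_ceilPolicy (hc : IsConvexEffortCost c) : Admissible c (ceilPolicy c) :=
  admissible_of_div_aStar_le hc (tendsto_ceilPolicy hc) (.of_forall fun _ => Nat.le_ceil _)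

lemma tendsto_totalCost_div_aStar (hc : IsConvexEffortCost c) (hw : 0 ≤ w) (hadm : Admissible c P)
    (hP : Tendsto (fun lam : ℝ => (P lam : ℝ) / lam) atTop (𝓝 (1 / aStar c))) :
    Tendsto (fun lam : ℝ => totalCost c cS w lam (P lam) / lam) atTop
      (𝓝 (cS * (1 / aStar c))) :=
  tendsto_totalCost_div hc hw hadm hP
    (qualityDriven_of_tendsto hc (one_div_pos.2 (aStar_pos hc)) hP)

lemma exists_forall_le_of_linear_le {S : Set ℕ} (hS : S.Nonempty) {f : ℕ → ℝ} {b : ℝ} (hb : 0 < b)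
    (hf : ∀ n ∈ S, b * n ≤ f n) : ∃ n ∈ S, ∀ k ∈ S, f n ≤ f k := by
  obtain ⟨k₀, hk₀⟩ := hS
  have hfin : (S ∩ Set.Iic ⌊f k₀ / b⌋₊).Finite := (Set.finite_Iic _).inter_of_right _
  have hmem : ∀ k ∈ S, f k ≤ f k₀ → k ∈ S ∩ Set.Iic ⌊f k₀ / b⌋₊ := fun k hk hle =>
    ⟨hk, Nat.le_floor ((le_div_iff₀' hb).2 ((hf k hk).trans hle))⟩
  obtain ⟨n, hn, hmin⟩ := Set.exists_min_image _ f hfin ⟨k₀, hmem k₀ hk₀ le_rfl⟩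
  refine ⟨n, hn.1, fun k hk => ?_⟩
  rcases le_total (f k) (f k₀) with h | h
  · exact hmin k (hmem k hk h)
  · exact (hmin k₀ (hmem k₀ hk₀ le_rfl)).trans h

lemma exists_isOptimalPolicy (hc : IsConvexEffortCost c) (hcS : 0 < cS) (hw : 0 ≤ w) :
    ∃ P : ℝ → ℕ, IsOptimalPolicy c cS w P := by
  have hargmin : ∀ lam : ℝ, (0 < lam ∧ ∃ k m, IsSymmetricEquilibrium c lam k m) →
      ∃ n, (∃ m, IsSymmetricEquilibrium c lam n m) ∧
        ∀ k, (∃ m, IsSymmetricEquilibrium c lam k m) →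
          totalCost c cS w lam n ≤ totalCost c cS w lam k := fun lam ⟨hlam, hex⟩ =>
    exists_forall_le_of_linear_le (S := {k | ∃ m, IsSymmetricEquilibrium c lam k m}) hex hcS
      fun _ ⟨_, h⟩ => h.mul_le_totalCost hc hw hlam
  choose! P hP using hargmin
  refine ⟨P, (admissible_iff hc).2 ?_, fun Q _ lam hlam hex => ?_⟩
  · filter_upwards [(admissible_ceilPolicy hc).1, eventually_gt_atTop 0] with lam hex hlam
    exact (hP lam ⟨hlam, _, hex⟩).1
  · obtain ⟨hexP, hmin⟩ := hP lam ⟨hlam, _, hex⟩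
    exact ⟨hexP, hmin _ hex⟩

lemma Admissible.eventually_lt_totalCost_div (hc : IsConvexEffortCost c) (hcS : 0 < cS)
    (hw : 0 ≤ w) (hadm : Admissible c P) {b : ℝ} (hb : b < cS * (1 / aStar c)) :
    ∀ᶠ lam in atTop, b < totalCost c cS w lam (P lam) / lam := by
  filter_upwards [eventually_lt_div_of_lt_one_div_aStar hc ((div_lt_iff₀' hcS).2 hb), hadm.1,
    eventually_gt_atTop 0] with lam hlt ⟨m, h⟩ hlam
  calc b < cS * (P lam / lam) := (div_lt_iff₀' hcS).1 (hlt _ m h)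
    _ = cS * P lam / lam := (mul_div_assoc _ _ _).symm
    _ ≤ totalCost c cS w lam (P lam) / lam :=
      div_le_div_of_nonneg_right (h.mul_le_totalCost hc hw hlam) hlam.le

lemma IsOptimalPolicy.tendsto_totalCost_div (hc : IsConvexEffortCost c) (hcS : 0 < cS)
    (hw : 0 ≤ w) (hP : IsOptimalPolicy c cS w P) :
    Tendsto (fun lam : ℝ => totalCost c cS w lam (P lam) / lam) atTop
      (𝓝 (cS * (1 / aStar c))) := by
  have hceil := admissible_ceilPolicy hc
  refine tendsto_order.2 ⟨fun b hb => hP.1.eventually_lt_totalCost_div hc hcS hw hb,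
    fun b hb => ?_⟩
  filter_upwards [(tendsto_totalCost_div_aStar (cS := cS) hc hw hceil
    (tendsto_ceilPolicy hc)).eventually (gt_mem_nhds hb), hceil.1, eventually_gt_atTop 0]
    with lam hlt hex hlam
  exact (div_le_div_of_nonneg_right (hP.2 _ hceil lam hlam hex).2 hlam.le).trans_lt hlt

lemma asymptoticallyOptimal_of_tendsto (hc : IsConvexEffortCost c) (hcS : 0 < cS) (hw : 0 ≤ w)
    (hadm : Admissible c P)
    (hP : Tendsto (fun lam : ℝ => (P lam : ℝ) / lam) atTop (𝓝 (1 / aStar c))) :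
    AsymptoticallyOptimal c cS w P := by
  refine ⟨hadm, fun Q hQ => ?_⟩
  have hne : cS * (1 / aStar c) ≠ 0 := (mul_pos hcS (one_div_pos.2 (aStar_pos hc))).ne'
  have hratio := (tendsto_totalCost_div_aStar (cS := cS) hc hw hadm hP).div
    (hQ.tendsto_totalCost_div hc hcS hw) hne
  rw [div_self hne] at hratio
  refine hratio.congr' ?_
  filter_upwards [eventually_ne_atTop 0] with lam hlam
  exact div_div_div_cancel_right₀ hlam _ _

end OptimalPolicies

end StrategicServers

open StrategicServers in
theorem theorem8_general (c : ℝ → ℝ) (hc : IsConvexEffortCost c) (cS w : ℝ) (hcS : 0 < cS)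
    (hw : 0 ≤ w) :
    (IsLUB (solvableSet c) (aStar c) ∧ 0 < aStar c) ∧
    (∃ Nopt : ℝ → ℕ, IsOptimalPolicy c cS w Nopt) ∧
    (∀ Nopt : ℝ → ℕ, IsOptimalPolicy c cS w Nopt →
      Tendsto (fun lam : ℝ => totalCost c cS w lam (Nopt lam) / lam) atTop
        (𝓝 (cS * (1 / aStar c)))) ∧
    ∀ Nao : ℝ → ℕ,
      (fun lam : ℝ => (Nao lam : ℝ) - 1 / aStar c * lam) =o[atTop] (fun lam : ℝ => lam) →
      ((∀ᶠ lam : ℝ in atTop, 0 ≤ (Nao lam : ℝ) - lam / aStar c) → Admissible c Nao) ∧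
      (Admissible c Nao →
        AsymptoticallyOptimal c cS w Nao ∧
        Tendsto (fun lam : ℝ => totalCost c cS w lam (Nao lam) / lam) atTop
          (𝓝 (cS * (1 / aStar c))) ∧
        QualityDriven c Nao) := by
  refine ⟨⟨(isGreatest_aStar hc).isLUB, aStar_pos hc⟩, exists_isOptimalPolicy hc hcS hw,
    fun _ hopt => hopt.tendsto_totalCost_div hc hcS hw, fun Nao hlittle => ?_⟩
  have hlim := tendsto_div_of_isLittleO hlittle
  refine ⟨fun hle => admissible_of_div_aStar_le hc hlim (hle.mono fun _ => sub_nonneg.1),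
    fun hadm => ⟨?_, ?_, ?_⟩⟩
  · exact asymptoticallyOptimal_of_tendsto hc hcS hw hadm hlim
  · exact tendsto_totalCost_div_aStar hc hw hadm hlim
  · exact qualityDriven_of_tendsto hc (one_div_pos.2 (aStar_pos hc)) hlim

theorem theorem8 (c : ℝ → ℝ) (hc : StrategicServers.IsEffortCost c)
    (cS w : ℝ) (hcS : 0 < cS) (hw : 0 ≤ w) :
    -- the supremum defining the parameter is a genuine one, and positive
    (IsLUB (StrategicServers.solvableSet c) (StrategicServers.aStar c) ∧
      0 < StrategicServers.aStar c) ∧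
    -- optimal policies exist, and their cost has the claimed growth
    (∃ Nopt : ℝ → ℕ, StrategicServers.IsOptimalPolicy c cS w Nopt) ∧
    (∀ Nopt : ℝ → ℕ, StrategicServers.IsOptimalPolicy c cS w Nopt →
      Tendsto (fun lam : ℝ => StrategicServers.totalCost c cS w lam (Nopt lam) / lam)
        atTop (𝓝 (cS * (1 / StrategicServers.aStar c)))) ∧
    ∀ Nao : ℝ → ℕ,
      (fun lam : ℝ => (Nao lam : ℝ) - 1 / StrategicServers.aStar c * lam)
        =o[atTop] (fun lam : ℝ => lam) →
      -- admissibility, when the lower order term is nonnegative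
      ((∀ᶠ lam : ℝ in atTop, 0 ≤ (Nao lam : ℝ) - lam / StrategicServers.aStar c) →
        StrategicServers.Admissible c Nao) ∧
      -- optimality, whenever the policy is admissible
      (StrategicServers.Admissible c Nao →
        StrategicServers.AsymptoticallyOptimal c cS w Nao ∧
        Tendsto (fun lam : ℝ => StrategicServers.totalCost c cS w lam (Nao lam) / lam)
          atTop (𝓝 (cS * (1 / StrategicServers.aStar c))) ∧
        StrategicServers.QualityDriven c Nao) :=
  theorem8_general c hc.isConvexEffortCost cS w hcS hw
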